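/- Let $\mathbf C=(\mathbb C,\otimes,I,\alpha,\lambda,\rho,\sigma)$ be a symmetric monoidal closed category whose underlying category $\mathbb C$ is additive, cocomplete and finitely complete. Let $\mathsf{Lie}(\mathbf C)$ be the category of internal Lie algebras in $\mathbf C$: an object is a pair $(X,b)$ with $b\colon X\otimes X\to X$ a morphism of $\mathbb C$ such that $$b\circ(\mathrm{id}+\sigma)=0,\qquad b\circ(\mathrm{id}\otimes b)\circ\bigl(\mathrm{id}+\sigma\alpha+(\sigma\alpha)^2\bigr)=0,$$ where $\sigma\alpha$ is the composite $X\otimes(X\otimes X)\xrightarrow{\alpha}(X\otimes X)\otimes X\xrightarrow{\sigma}X\otimes(X\otimes X)$, and a morphism $(X,b)\to(X',b')$ is a morphism $f\colon X\to X'$ of $\mathbb C$ with $f\circ b=b'\circ(f\otimes f)$. Then $\mathsf{Lie}(\mathbf C)$ is locally algebraically cartesian closed (LACC). That is, $\mathsf{Lie}(\mathbf C)$ is finitely complete, and for every morphism $q\colon E\to B$ of $\mathsf{Lie}(\mathbf C)$ the change-of-base functor $$q^*\colon \mathsf{Pt}_B(\mathsf{Lie}(\mathbf C))\to\mathsf{Pt}_E(\mathsf{Lie}(\mathbf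 C)),\qquad (A,p,s)\mapsto(E\times_BA,\ \pi_1,\ \langle \mathrm{id},sq\rangle),$$ has a right adjoint. Here $\mathsf{Pt}_B(\mathbb D)$ is the category of points over $B$: an object $(A,p,s)$ consists of morphisms $p\colon A\to B$ and $s\colon B\to A$ with $ps=1_B$, and a morphism $(A,p,s)\to(A',p',s')$ is a morphism $f\colon A\to A'$ with $p'f=p$ and $fs=s'$. -/

import Mathlib

open CategoryTheory CategoryTheory.Limits MonoidalCategory

universe v u

/-! Internal Lie algebras in a symmetric monoidal preadditive category. -/

/-- The cyclic permutation `σα : X ⊗ (X ⊗ X) ⟶ (X ⊗ X) ⊗ X ⟶ X ⊗ (X ⊗ X)`. -/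
def cyclicPerm {C : Type u} [Category.{v} C] [MonoidalCategory C] [SymmetricCategory C] (X : C) :
    X ⊗ (X ⊗ X) ⟶ X ⊗ (X ⊗ X) :=
  (α_ X X X).inv ≫ (β_ (X ⊗ X) X).hom

/-- An internal Lie algebra: an object with a bracket `b : X ⊗ X ⟶ X` such that
`b ∘ (id + σ) = 0` and `b ∘ (id ⊗ b) ∘ (id + σα + (σα)²) = 0`. -/
structure LieObj (C : Type u) [Category.{v} C] [Preadditive C] [MonoidalCategory C]
    [SymmetricCategory C] where
  /-- the underlying object -/
  X : C
  /-- the bracket -/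
  bracket : X ⊗ X ⟶ X
  antisymm : (𝟙 (X ⊗ X) + (β_ X X).hom) ≫ bracket = 0
  jacobi : (𝟙 (X ⊗ (X ⊗ X)) + cyclicPerm X + cyclicPerm X ≫ cyclicPerm X) ≫
    (X ◁ bracket) ≫ bracket = 0

namespace LieObj

variable {C : Type u} [Category.{v} C] [Preadditive C] [MonoidalCategory C] [SymmetricCategory C]

/-- A morphism of internal Lie algebras: a morphism of `C` that preserves the brackets. -/
@[ext]
structure Hom (L M : LieObj C) where
  /-- the underlying morphism -/
  hom : L.X ⟶ M.X
  map_bracket : L.bracket ≫ hom = (hom ⊗ₘ hom) ≫ M.bracket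

/-- The category of internal Lie algebras in `C`. -/
instance : Category.{v} (LieObj C) where
  Hom L M := Hom L M
  id L := { hom := 𝟙 L.X, map_bracket := by simp }
  comp f g :=
    { hom := f.hom ≫ g.hom
      map_bracket := by
        rw [← Category.assoc, f.map_bracket, Category.assoc, g.map_bracket,
          ← Category.assoc, MonoidalCategory.tensorHom_comp_tensorHom] }
  id_comp f := Hom.ext (Category.id_comp f.hom)
  comp_id f := Hom.ext (Category.comp_id f.hom)
  assoc f g h := Hom.ext (Category.assoc f.hom g.hom h.hom)

end LieObj

/-! Categories of points and local algebraic cartesian closedness. -/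

/-- A point over `B`: a split epimorphism `p : A ⟶ B` with a chosen section `s : B ⟶ A`. -/
structure Pt {D : Type u} [Category.{v} D] (B : D) where
  /-- the domain of the split epimorphism -/
  A : D
  /-- the split epimorphism -/
  p : A ⟶ B
  /-- the chosen section -/
  s : B ⟶ A
  s_p : s ≫ p = 𝟙 B

namespace Pt

variable {D : Type u} [Category.{v} D]

/-- A morphism of points over `B`. -/
@[ext]
structure Hom {B : D} (P Q : Pt B) where
  /-- the underlying morphism -/
  hom : P.A ⟶ Q.A
  hom_p : hom ≫ Q.p = P.p
  s_hom : P.s ≫ hom = Q.s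

/-- The category of points over `B`. -/
instance (B : D) : Category.{v} (Pt B) where
  Hom P Q := Hom P Q
  id P := { hom := 𝟙 P.A, hom_p := Category.id_comp _, s_hom := Category.comp_id _ }
  comp f g :=
    { hom := f.hom ≫ g.hom
      hom_p := by rw [Category.assoc, g.hom_p, f.hom_p]
      s_hom := by rw [← Category.assoc, f.s_hom, g.s_hom] }
  id_comp f := Hom.ext (Category.id_comp f.hom)
  comp_id f := Hom.ext (Category.comp_id f.hom)
  assoc f g h := Hom.ext (Category.assoc f.hom g.hom h.hom)

/-- The point `(E ×_B A, π₁, ⟨id, s ∘ q⟩)` over `E` obtained from a point `(A, p, s)` over `B` by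
pulling back along `q : E ⟶ B`. -/
noncomputable def baseChange [HasPullbacks D] {E B : D} (q : E ⟶ B) (P : Pt B) : Pt E where
  A := pullback q P.p
  p := pullback.fst q P.p
  s := pullback.lift (𝟙 E) (q ≫ P.s) (by simp [P.s_p])
  s_p := pullback.lift_fst _ _ _

/-- The morphism `id ×_B f` between pulled back points. -/
noncomputable def baseChangeMap [HasPullbacks D] {E B : D} (q : E ⟶ B) {P Q : Pt B}
    (f : P ⟶ Q) : pullback q P.p ⟶ pullback q Q.p :=
  pullback.lift (pullback.fst q P.p) (pullback.snd q P.p ≫ f.hom)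
    (pullback.condition.trans
      ((congrArg (pullback.snd q P.p ≫ ·) f.hom_p.symm).trans (Category.assoc _ _ _).symm))

theorem baseChangeMap_fst [HasPullbacks D] {E B : D} (q : E ⟶ B) {P Q : Pt B} (f : P ⟶ Q) :
    baseChangeMap q f ≫ pullback.fst q Q.p = pullback.fst q P.p :=
  pullback.lift_fst _ _ _

theorem baseChangeMap_snd [HasPullbacks D] {E B : D} (q : E ⟶ B) {P Q : Pt B} (f : P ⟶ Q) :
    baseChangeMap q f ≫ pullback.snd q Q.p = pullback.snd q P.p ≫ f.hom :=
  pullback.lift_snd _ _ _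

/-- The change-of-base functor `q^* : Pt B ⥤ Pt E` along `q : E ⟶ B`. -/
noncomputable def changeOfBase [HasPullbacks D] {E B : D} (q : E ⟶ B) : Pt B ⥤ Pt E where
  obj P := baseChange q P
  map {P Q} f :=
    { hom := baseChangeMap q f
      hom_p := baseChangeMap_fst q f
      s_hom := by
        dsimp only [baseChange]
        apply pullback.hom_ext
        · rw [Category.assoc, baseChangeMap_fst, pullback.lift_fst, pullback.lift_fst]
        · rw [Category.assoc, baseChangeMap_snd, pullback.lift_snd, pullback.lift_snd_assoc,
            Category.assoc, f.s_hom] }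
  map_id P := Hom.ext (by
    change baseChangeMap q (𝟙 P) = 𝟙 (pullback q P.p)
    apply pullback.hom_ext
    · rw [baseChangeMap_fst, Category.id_comp]
    · rw [baseChangeMap_snd, Category.id_comp]
      exact Category.comp_id _)
  map_comp {P Q R} f g := Hom.ext (by
    change baseChangeMap q (f ≫ g) = baseChangeMap q f ≫ baseChangeMap q g
    apply pullback.hom_ext
    · rw [Category.assoc, baseChangeMap_fst, baseChangeMap_fst, baseChangeMap_fst]
    · rw [Category.assoc, baseChangeMap_snd, baseChangeMap_snd, ← Category.assoc,
        baseChangeMap_snd, Category.assoc]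
      rfl)

end Pt

/-- A category is locally algebraically cartesian closed if it is finitely complete and every
change-of-base functor between its categories of points has a right adjoint. -/
class LocallyAlgebraicallyCartesianClosed (D : Type u) [Category.{v} D] : Prop where
  hasFiniteLimits : HasFiniteLimits D
  changeOfBase_isLeftAdjoint {E B : D} (q : E ⟶ B) : (Pt.changeOfBase q).IsLeftAdjoint

section Cyclic

variable {C : Type u} [Category.{v} C] [MonoidalCategory C] [SymmetricCategory C]

/-- The cyclic permutation `P ⊗ (Q ⊗ R) ⟶ R ⊗ (P ⊗ Q)` of three possibly distinct factors. -/
def cyc (P Q R : C) : P ⊗ (Q ⊗ R) ⟶ R ⊗ (P ⊗ Q) :=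
  (α_ P Q R).inv ≫ (β_ (P ⊗ Q) R).hom

theorem cyc_naturality {P Q R P' Q' R' : C} (f : P ⟶ P') (g : Q ⟶ Q') (h : R ⟶ R') :
    (f ⊗ₘ (g ⊗ₘ h)) ≫ cyc P' Q' R' = cyc P Q R ≫ (h ⊗ₘ (f ⊗ₘ g)) := by
  rw [cyc, cyc, Category.assoc, ← BraidedCategory.braiding_naturality,
    ← associator_inv_naturality_assoc]

theorem cyc_naturality_assoc {P Q R P' Q' R' Z : C} (f : P ⟶ P') (g : Q ⟶ Q') (h : R ⟶ R')
    (k : R' ⊗ (P' ⊗ Q') ⟶ Z) :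
    (f ⊗ₘ (g ⊗ₘ h)) ≫ cyc P' Q' R' ≫ k = cyc P Q R ≫ (h ⊗ₘ (f ⊗ₘ g)) ≫ k := by
  rw [← Category.assoc, cyc_naturality, Category.assoc]

theorem cyc_cyc (P Q R : C) : cyc P Q R ≫ cyc R P Q = (β_ P (Q ⊗ R)).hom ≫ (α_ Q R P).hom := by
  have h : cyc P Q R ≫ (α_ R P Q).inv = P ◁ (β_ Q R).hom ≫ (α_ P R Q).inv ≫ (β_ P R).hom ▷ Q := by
    rw [← BraidedCategory.hexagon_reverse, cyc, Category.assoc]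
  rw [cyc.eq_def R P Q, reassoc_of% h,
    BraidedCategory.braiding_naturality_left, BraidedCategory.braiding_tensor_left_hom P R Q,
    BraidedCategory.braiding_tensor_right_hom P Q R]
  simp only [Category.assoc, Iso.inv_hom_id, Category.comp_id, Iso.inv_hom_id_assoc]
  rw [← whiskerLeft_comp_assoc, SymmetricCategory.symmetry, whiskerLeft_id, Category.id_comp]

theorem cyc_cyc_cyc (P Q R : C) : cyc P Q R ≫ cyc R P Q ≫ cyc Q R P = 𝟙 _ := by
  rw [← Category.assoc, cyc_cyc, cyc, Category.assoc, Iso.hom_inv_id_assoc,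
    SymmetricCategory.symmetry]

theorem cyc_cyc_whiskerLeft_braiding (P Q R : C) :
    cyc P Q R ≫ cyc R P Q ≫ Q ◁ (β_ R P).hom =
      (α_ P Q R).inv ≫ (β_ P Q).hom ▷ R ≫ (α_ Q P R).hom := by
  rw [← Category.assoc, cyc_cyc, BraidedCategory.braiding_tensor_right_hom]
  simp only [Category.assoc, Iso.inv_hom_id_assoc]
  rw [← whiskerLeft_comp, SymmetricCategory.symmetry, whiskerLeft_id, Category.comp_id]

end Cyclic

section Bracket

variable {C : Type u} [Category.{v} C] [MonoidalCategory C]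

/-- The bracket `[f, g]` of two generalized elements. -/
def brk {A P Q : C} (b : A ⊗ A ⟶ A) (f : P ⟶ A) (g : Q ⟶ A) : P ⊗ Q ⟶ A :=
  (f ⊗ₘ g) ≫ b

theorem tensorHom_comp_brk {A P Q P' Q' : C} (b : A ⊗ A ⟶ A) (f : P ⟶ A) (g : Q ⟶ A)
    (f' : P' ⟶ P) (g' : Q' ⟶ Q) : (f' ⊗ₘ g') ≫ brk b f g = brk b (f' ≫ f) (g' ≫ g) := by
  simp [brk]

theorem brk_comp {A A' P Q : C} {b : A ⊗ A ⟶ A} {b' : A' ⊗ A' ⟶ A'} {k : A ⟶ A'}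
    (hk : b ≫ k = (k ⊗ₘ k) ≫ b') (f : P ⟶ A) (g : Q ⟶ A) :
    brk b f g ≫ k = brk b' (f ≫ k) (g ≫ k) := by
  simp [brk, hk]

variable [Preadditive C]

theorem brk_add [MonoidalPreadditive C] {A P Q : C} (b : A ⊗ A ⟶ A) (f : P ⟶ A) (g h : Q ⟶ A) :
    brk b f (g + h) = brk b f g + brk b f h := by
  simp [brk, tensorHom_def', Preadditive.add_comp]

theorem brk_zero [MonoidalPreadditive C] {A P Q : C} (b : A ⊗ A ⟶ A) (f : P ⟶ A) :
    brk b f (0 : Q ⟶ A) = 0 := by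
  simp [brk, tensorHom_def']

theorem brk_neg [MonoidalPreadditive C] {A P Q : C} (b : A ⊗ A ⟶ A) (f : P ⟶ A) (g : Q ⟶ A) :
    brk b f (-g) = -brk b f g := by
  rw [eq_neg_iff_add_eq_zero, ← brk_add, neg_add_cancel, brk_zero]

variable [SymmetricCategory C]

/-- The bracket `b` is antisymmetric. -/
def IsSkew {A : C} (b : A ⊗ A ⟶ A) : Prop := (β_ A A).hom ≫ b = -b

theorem isSkew_iff {A : C} (b : A ⊗ A ⟶ A) :
    IsSkew b ↔ (𝟙 (A ⊗ A) + (β_ A A).hom) ≫ b = 0 := by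
  rw [IsSkew, Preadditive.add_comp, Category.id_comp, eq_neg_iff_add_eq_zero, add_comm]

theorem IsSkew.braiding_brk {A P Q : C} {b : A ⊗ A ⟶ A} (hb : IsSkew b) (f : P ⟶ A)
    (g : Q ⟶ A) : (β_ P Q).hom ≫ brk b g f = -brk b f g := by
  rw [brk, ← BraidedCategory.braiding_naturality_assoc, hb, brk, Preadditive.comp_neg]

/-- The Jacobiator of three generalized elements. -/
def jac {A P Q R : C} (b : A ⊗ A ⟶ A) (f : P ⟶ A) (g : Q ⟶ A) (h : R ⟶ A) :
    P ⊗ (Q ⊗ R) ⟶ A :=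
  brk b f (brk b g h) + cyc P Q R ≫ brk b h (brk b f g) +
    (cyc P Q R ≫ cyc R P Q) ≫ brk b g (brk b h f)

theorem jac_id {A : C} (b : A ⊗ A ⟶ A) : jac b (𝟙 A) (𝟙 A) (𝟙 A) =
    (𝟙 (A ⊗ (A ⊗ A)) + cyclicPerm A + cyclicPerm A ≫ cyclicPerm A) ≫ (A ◁ b) ≫ b := by
  simp [jac, brk, cyc, cyclicPerm, Preadditive.add_comp]

theorem jac_eq_tensorHom_comp {A P Q R : C} (b : A ⊗ A ⟶ A) (f : P ⟶ A) (g : Q ⟶ A) (h : R ⟶ A) :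
    jac b f g h = (f ⊗ₘ (g ⊗ₘ h)) ≫ jac b (𝟙 A) (𝟙 A) (𝟙 A) := by
  simp only [jac, Preadditive.comp_add, Category.assoc, cyc_naturality_assoc, tensorHom_comp_brk,
    Category.comp_id]

theorem cyc_comp_jac {A P Q R : C} (b : A ⊗ A ⟶ A) (f : P ⟶ A) (g : Q ⟶ A) (h : R ⟶ A) :
    cyc P Q R ≫ jac b h f g = jac b f g h := by
  simp only [jac, Preadditive.comp_add, Category.assoc]
  have := cyc_cyc_cyc P Q R
  rw [reassoc_of% this]
  abel

theorem jac_rotate {A P Q R : C} {b : A ⊗ A ⟶ A} {f : P ⟶ A} {g : Q ⟶ A} {h : R ⟶ A}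
    (H : jac b f g h = 0) : jac b h f g = 0 := by
  rw [← cyc_comp_jac, ← cyc_comp_jac, H, comp_zero, comp_zero]

theorem jac_eq_zero_iff [MonoidalPreadditive C] {A P Q R : C} {b : A ⊗ A ⟶ A} (hb : IsSkew b)
    (f : P ⟶ A) (g : Q ⟶ A) (h : R ⟶ A) :
    jac b f g h = 0 ↔ brk b (brk b f g) h = (α_ P Q R).hom ≫ brk b f (brk b g h) -
      (β_ P Q).hom ▷ R ≫ (α_ Q P R).hom ≫ brk b g (brk b f h) := by
  have h1 : cyc P Q R ≫ brk b h (brk b f g) = - (α_ P Q R).inv ≫ brk b (brk b f g) h := by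
    rw [cyc, Category.assoc, hb.braiding_brk]
    simp
  have h2 : (cyc P Q R ≫ cyc R P Q) ≫ brk b g (brk b h f) =
      - (α_ P Q R).inv ≫ (β_ P Q).hom ▷ R ≫ (α_ Q P R).hom ≫ brk b g (brk b f h) := by
    have e : brk b g (brk b h f) = - Q ◁ (β_ R P).hom ≫ brk b g (brk b f h) := by
      rw [← id_tensorHom, tensorHom_comp_brk, hb.braiding_brk, brk_neg, Category.id_comp, neg_neg]
    have := cyc_cyc_whiskerLeft_braiding P Q R
    rw [e, Category.assoc, Preadditive.comp_neg, Preadditive.comp_neg, reassoc_of% this]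
  rw [jac, h1, h2, ← cancel_epi (α_ P Q R).hom]
  simp only [Preadditive.comp_add, Preadditive.comp_neg, Iso.hom_inv_id_assoc, comp_zero]
  constructor
  · intro H
    rw [← sub_eq_zero, ← neg_eq_zero, ← H]
    abel
  · intro H
    rw [H]
    abel

end Bracket

namespace LieObj

variable {C : Type u} [Category.{v} C] [Preadditive C] [MonoidalCategory C] [SymmetricCategory C]

theorem isSkew (L : LieObj C) : IsSkew L.bracket := (isSkew_iff _).2 L.antisymm

theorem jac_eq_zero (L : LieObj C) {P Q R : C} (f : P ⟶ L.X) (g : Q ⟶ L.X) (h : R ⟶ L.X) :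
    jac L.bracket f g h = 0 := by
  rw [jac_eq_tensorHom_comp, jac_id, L.jacobi, comp_zero]

theorem leibniz [MonoidalPreadditive C] (L : LieObj C) {P Q R : C} (f : P ⟶ L.X) (g : Q ⟶ L.X)
    (h : R ⟶ L.X) :
    brk L.bracket (brk L.bracket f g) h = (α_ P Q R).hom ≫ brk L.bracket f (brk L.bracket g h) -
      (β_ P Q).hom ▷ R ≫ (α_ Q P R).hom ≫ brk L.bracket g (brk L.bracket f h) :=
  (jac_eq_zero_iff L.isSkew f g h).1 (L.jac_eq_zero f g h)

@[ext]
theorem hom_ext {L M : LieObj C} {f g : L ⟶ M} (h : f.hom = g.hom) : f = g := Hom.ext h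

@[simp] theorem id_hom (L : LieObj C) : Hom.hom (𝟙 L) = 𝟙 L.X := rfl

@[simp] theorem comp_hom {L M N : LieObj C} (f : L ⟶ M) (g : M ⟶ N) :
    (f ≫ g).hom = f.hom ≫ g.hom := rfl

variable (C) in
/-- The underlying object functor. -/
@[simps]
def forget : LieObj C ⥤ C where
  obj L := L.X
  map f := f.hom

/-- A morphism of Lie algebras whose underlying morphism is invertible is invertible. -/
@[simps]
def isoMk {L M : LieObj C} (e : L.X ≅ M.X) (h : L.bracket ≫ e.hom = (e.hom ⊗ₘ e.hom) ≫ M.bracket) :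
    L ≅ M where
  hom := ⟨e.hom, h⟩
  inv := ⟨e.inv, by rw [← cancel_mono e.hom, Category.assoc, Category.assoc, h]; simp⟩
  hom_inv_id := hom_ext e.hom_inv_id
  inv_hom_id := hom_ext e.inv_hom_id

theorem jac_comp {A A' P Q R : C} {b : A ⊗ A ⟶ A} {b' : A' ⊗ A' ⟶ A'} {k : A ⟶ A'}
    (hk : b ≫ k = (k ⊗ₘ k) ≫ b') (f : P ⟶ A) (g : Q ⟶ A) (h : R ⟶ A) :
    jac b f g h ≫ k = jac b' (f ≫ k) (g ≫ k) (h ≫ k) := by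
  simp only [jac, Preadditive.add_comp, Category.assoc, brk_comp hk]

section Limits

variable {J : Type*} [Category J] {F : J ⥤ LieObj C}

/-- The legs of a cone over the underlying objects. -/
def leg (c : Cone (F ⋙ forget C)) (j : J) : c.pt ⟶ (F.obj j).X := c.π.app j

theorem leg_map (c : Cone (F ⋙ forget C)) {i j : J} (f : i ⟶ j) :
    leg c i ≫ (F.map f).hom = leg c j := c.w f

variable {c : Cone (F ⋙ forget C)} (hc : IsLimit c)

/-- The morphism into a limit of the underlying objects given by a compatible family. -/
def legLift {Z : C} (f : ∀ j, Z ⟶ (F.obj j).X)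
    (hf : ∀ (i j : J) (u : i ⟶ j), f i ≫ (F.map u).hom = f j) : Z ⟶ c.pt :=
  hc.lift ⟨Z, { app := f, naturality := fun i j u => (Category.id_comp _).trans (hf i j u).symm }⟩

theorem legLift_leg {Z : C} (f : ∀ j, Z ⟶ (F.obj j).X)
    (hf : ∀ (i j : J) (u : i ⟶ j), f i ≫ (F.map u).hom = f j) (j : J) :
    legLift hc f hf ≫ leg c j = f j := hc.fac _ j

include hc in
theorem leg_ext {Z : C} {f g : Z ⟶ c.pt} (h : ∀ j, f ≫ leg c j = g ≫ leg c j) : f = g :=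
  hc.hom_ext h

/-- The Lie algebra structure on an object with a jointly monic family of bracket preserving
morphisms to Lie algebras. -/
abbrev ofJointlyMonic {X : C} (b : X ⊗ X ⟶ X) {M : J → LieObj C} (π : ∀ j, X ⟶ (M j).X)
    (hπ : ∀ {Z : C} {f g : Z ⟶ X}, (∀ j, f ≫ π j = g ≫ π j) → f = g)
    (hb : ∀ j, b ≫ π j = (π j ⊗ₘ π j) ≫ (M j).bracket) : LieObj C where
  X := X
  bracket := b
  antisymm := hπ fun j => by
    rw [zero_comp, Category.assoc, hb, Preadditive.add_comp, Category.id_comp,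
      ← BraidedCategory.braiding_naturality_assoc, (M j).isSkew, Preadditive.comp_neg,
      add_neg_cancel]
  jacobi := hπ fun j => by
    rw [zero_comp, ← jac_id, jac_comp (hb j), jac_eq_zero]

/-- The bracket on the limit of the underlying objects. -/
def limitBracket : c.pt ⊗ c.pt ⟶ c.pt :=
  legLift hc (fun j => brk (F.obj j).bracket (leg c j) (leg c j))
    fun _ _ u => by rw [brk_comp (F.map u).map_bracket, leg_map]

theorem limitBracket_leg (j : J) :
    limitBracket hc ≫ leg c j = (leg c j ⊗ₘ leg c j) ≫ (F.obj j).bracket :=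
  legLift_leg hc (fun j => brk (F.obj j).bracket (leg c j) (leg c j))
    (fun _ _ u => by rw [brk_comp (F.map u).map_bracket, leg_map]) j

/-- The Lie algebra structure on the limit of the underlying objects. -/
abbrev limitObj : LieObj C :=
  ofJointlyMonic (limitBracket hc) (leg c) (leg_ext hc) (limitBracket_leg hc)

/-- The legs of the limit cone of Lie algebras. -/
def limitLeg (j : J) : limitObj hc ⟶ F.obj j := ⟨leg c j, limitBracket_leg hc j⟩

/-- The limit cone of Lie algebras. -/
@[simps]
def limitCone : Cone F where
  pt := limitObj hc
  π :=
    { app j := limitLeg hc j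
      naturality _ _ f := hom_ext (c.π.naturality f) }

/-- The morphism of Lie algebras to the limit given by a compatible family. -/
def limitLift {L : LieObj C} (f : ∀ j, L ⟶ F.obj j)
    (hf : ∀ (i j : J) (u : i ⟶ j), f i ≫ F.map u = f j) : L ⟶ limitObj hc where
  hom := legLift hc (fun j => (f j).hom) fun i j u => by rw [← comp_hom, hf]
  map_bracket := leg_ext hc fun j => by
    have h := legLift_leg hc (fun j => (f j).hom) (fun i j u => by rw [← comp_hom, hf]) j
    have h' : (limitObj hc).bracket ≫ leg c j = _ := (limitLeg hc j).map_bracket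
    rw [Category.assoc, h, Category.assoc, h']
    refine (f j).map_bracket.trans (Eq.trans ?_ (tensorHom_comp_tensorHom_assoc _ _ _ _ _).symm)
    exact congrArg (fun k => (k ⊗ₘ k) ≫ _) h.symm

theorem limitLift_limitLeg {L : LieObj C} (f : ∀ j, L ⟶ F.obj j)
    (hf : ∀ (i j : J) (u : i ⟶ j), f i ≫ F.map u = f j) (j : J) :
    limitLift hc f hf ≫ limitLeg hc j = f j :=
  hom_ext (legLift_leg hc _ (fun i j u => by rw [← comp_hom, hf]) j)

/-- The limit cone of Lie algebras is a limit. -/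
def limitConeIsLimit : IsLimit (limitCone hc) where
  lift s := limitLift hc s.π.app fun _ _ u => s.w u
  fac _ j := limitLift_limitLeg hc _ _ j
  uniq _ _ hm := hom_ext (leg_ext hc fun j =>
    congrArg Hom.hom ((hm j).trans (limitLift_limitLeg hc _ _ j).symm))

end Limits

instance [HasFiniteLimits C] : HasFiniteLimits (LieObj C) where
  out _ _ _ := ⟨fun F => ⟨⟨_, limitConeIsLimit (limit.isLimit (F ⋙ forget C))⟩⟩⟩

end LieObj

section Whisker

variable {C : Type u} [Category.{v} C] [Preadditive C] [MonoidalCategory C] [MonoidalPreadditive C]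

theorem sub_whiskerRight {X X' : C} (f g : X ⟶ X') (Y : C) : (f - g) ▷ Y = f ▷ Y - g ▷ Y :=
  (tensorRight Y).map_sub

end Whisker

section TensorAction

variable {C : Type u} [Category.{v} C] [MonoidalCategory C] [SymmetricCategory C]

/-- The action of the first factor on a tensor product. -/
def actLeft {B X : C} (a : B ⊗ X ⟶ X) (Y : C) : B ⊗ (X ⊗ Y) ⟶ X ⊗ Y :=
  (α_ B X Y).inv ≫ a ▷ Y

/-- The action of the second factor on a tensor product. -/
def actRight {B Y : C} (X : C) (a : B ⊗ Y ⟶ Y) : B ⊗ (X ⊗ Y) ⟶ X ⊗ Y :=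
  (α_ B X Y).inv ≫ (β_ B X).hom ▷ Y ≫ (α_ X B Y).hom ≫ X ◁ a

theorem actRight_eq {B Y : C} (X : C) (a : B ⊗ Y ⟶ Y) :
    actRight X a = B ◁ (β_ X Y).hom ≫ actLeft a X ≫ (β_ Y X).hom := by
  rw [actLeft, Category.assoc, BraidedCategory.braiding_naturality_left,
    BraidedCategory.braiding_tensor_left_hom, actRight]
  simp only [Category.assoc, Iso.inv_hom_id_assoc]
  rw [← whiskerLeft_comp_assoc, SymmetricCategory.symmetry, whiskerLeft_id, Category.id_comp]

theorem whiskerLeft_braiding_actLeft {B Y : C} (X : C) (a : B ⊗ Y ⟶ Y) :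
    B ◁ (β_ X Y).hom ≫ actLeft a X = actRight X a ≫ (β_ X Y).hom := by
  rw [actRight_eq]; simp

theorem whiskerLeft_braiding_actRight {B X : C} (a : B ⊗ X ⟶ X) (Y : C) :
    B ◁ (β_ X Y).hom ≫ actRight Y a = actLeft a Y ≫ (β_ X Y).hom := by
  rw [actRight_eq, ← whiskerLeft_comp_assoc, SymmetricCategory.symmetry, whiskerLeft_id,
    Category.id_comp]

theorem actRight_actLeft {B X Y : C} (a : B ⊗ X ⟶ X) (a' : B ⊗ Y ⟶ Y) :
    (α_ B B (X ⊗ Y)).hom ≫ B ◁ actRight X a' ≫ actLeft a Y =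
      (β_ B B).hom ▷ (X ⊗ Y) ≫ (α_ B B (X ⊗ Y)).hom ≫ B ◁ actLeft a Y ≫ actRight X a' := by
  have hl : actRight X a' = (α_ B X Y).inv ≫ (β_ B X).hom ▷ Y ≫ (α_ X B Y).hom ≫ X ◁ a' := rfl
  have e : (β_ B B).hom ▷ (X ⊗ Y) ≫ (α_ B B (X ⊗ Y)).hom ≫ B ◁ (α_ B X Y).inv ≫
      (α_ B (B ⊗ X) Y).inv ≫ (β_ B (B ⊗ X)).hom ▷ Y ≫ (α_ (B ⊗ X) B Y).hom =
      (α_ B B (X ⊗ Y)).hom ≫ B ◁ (α_ B X Y).inv ≫ B ◁ (β_ B X).hom ▷ Y ≫ B ◁ (α_ X B Y).hom ≫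
        (α_ B X (B ⊗ Y)).inv := by
    rw [BraidedCategory.braiding_tensor_right_hom]
    have : (β_ B B).hom ▷ (X ⊗ Y) ≫ (α_ B B (X ⊗ Y)).hom ≫ B ◁ (α_ B X Y).inv ≫
        (α_ B (B ⊗ X) Y).inv ≫ (α_ B B X).inv ▷ Y =
        (α_ _ _ _).inv ≫ (β_ B B).hom ▷ X ▷ Y := by
      rw [whiskerRight_tensor]
      simp
    simp only [comp_whiskerRight, Category.assoc]
    rw [reassoc_of% this, ← comp_whiskerRight_assoc, ← comp_whiskerRight,
      ← comp_whiskerRight_assoc, SymmetricCategory.symmetry]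
    simp
  have h1 : (α_ B (B ⊗ X) Y).inv ≫ (β_ B (B ⊗ X)).hom ▷ Y ≫ (α_ (B ⊗ X) B Y).hom ≫
      (B ⊗ X) ◁ a' ≫ a ▷ Y = B ◁ a ▷ Y ≫ actRight X a' := by
    rw [whisker_exchange, hl, associator_inv_naturality_middle_assoc, ← comp_whiskerRight_assoc,
      BraidedCategory.braiding_naturality_right]
    simp
  simp only [actLeft, hl, whiskerLeft_comp, Category.assoc]
  rw [← hl, ← h1, reassoc_of% e]
  simp

end TensorAction

section LieAction

variable {C : Type u} [Category.{v} C] [Preadditive C] [MonoidalCategory C] [SymmetricCategory C]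

/-- The obstruction for an operator to be an action of a Lie algebra. -/
def lieDefect (L : LieObj C) {X : C} (a : L.X ⊗ X ⟶ X) : (L.X ⊗ L.X) ⊗ X ⟶ X :=
  L.bracket ▷ X ≫ a - ((α_ L.X L.X X).hom ≫ L.X ◁ a ≫ a -
    (β_ L.X L.X).hom ▷ X ≫ (α_ L.X L.X X).hom ≫ L.X ◁ a ≫ a)

/-- The operator `a` is an action of the Lie algebra `L` on `X`. -/
def IsLieAction (L : LieObj C) {X : C} (a : L.X ⊗ X ⟶ X) : Prop :=
  lieDefect L a = 0

theorem isLieAction_iff {L : LieObj C} {X : C} (a : L.X ⊗ X ⟶ X) : IsLieAction L a ↔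
    L.bracket ▷ X ≫ a = (α_ L.X L.X X).hom ≫ L.X ◁ a ≫ a -
      (β_ L.X L.X).hom ▷ X ≫ (α_ L.X L.X X).hom ≫ L.X ◁ a ≫ a :=
  sub_eq_zero

variable {L : LieObj C}

theorem lieDefect_naturality {X Y : C} {a : L.X ⊗ X ⟶ X} {a' : L.X ⊗ Y ⟶ Y} {e : X ⟶ Y}
    (he : a ≫ e = L.X ◁ e ≫ a') : lieDefect L a ≫ e = (L.X ⊗ L.X) ◁ e ≫ lieDefect L a' := by
  have h1 : (α_ L.X L.X X).hom ≫ L.X ◁ a ≫ a ≫ e =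
      _ ◁ e ≫ (α_ L.X L.X Y).hom ≫ L.X ◁ a' ≫ a' := by
    rw [he, ← whiskerLeft_comp_assoc, he]
    simp
  simp only [lieDefect, Preadditive.sub_comp, Preadditive.comp_sub, Category.assoc, h1]
  rw [he, ← whisker_exchange_assoc, ← whisker_exchange_assoc]

theorem IsLieAction.of_mono {X Y : C} {a : L.X ⊗ X ⟶ X} {a' : L.X ⊗ Y ⟶ Y} (h : IsLieAction L a')
    (e : X ⟶ Y) [Mono e] (he : a ≫ e = L.X ◁ e ≫ a') : IsLieAction L a := by
  rw [IsLieAction, ← cancel_mono e, lieDefect_naturality he, h, comp_zero, zero_comp]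

theorem lieDefect_conj {X Y : C} (a : L.X ⊗ X ⟶ X) (e : Y ≅ X) :
    lieDefect L (L.X ◁ e.hom ≫ a ≫ e.inv) = (L.X ⊗ L.X) ◁ e.hom ≫ lieDefect L a ≫ e.inv := by
  have h : (L.X ◁ e.hom ≫ a ≫ e.inv) ≫ e.hom = L.X ◁ e.hom ≫ a := by simp
  rw [← cancel_mono e.hom, lieDefect_naturality h]
  simp

theorem IsLieAction.restrict {M : LieObj C} (q : M ⟶ L) {X : C} {a : L.X ⊗ X ⟶ X}
    (h : IsLieAction L a) : IsLieAction M (q.hom ▷ X ≫ a) := by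
  have h1 : (α_ M.X M.X X).hom ≫ M.X ◁ (q.hom ▷ X ≫ a) ≫ q.hom ▷ X ≫ a =
      (q.hom ⊗ₘ q.hom) ▷ X ≫ (α_ L.X L.X X).hom ≫ L.X ◁ a ≫ a := by
    simp [MonoidalCategory.tensorHom_def', whisker_exchange_assoc]
  rw [isLieAction_iff, h1, ← comp_whiskerRight_assoc, q.map_bracket, comp_whiskerRight,
    Category.assoc,
    (isLieAction_iff a).1 h, Preadditive.comp_sub, ← comp_whiskerRight_assoc,
    ← comp_whiskerRight_assoc,
    BraidedCategory.braiding_naturality]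

variable [MonoidalPreadditive C]

theorem IsLieAction.add {W : C} {l r : L.X ⊗ W ⟶ W} (hl : IsLieAction L l) (hr : IsLieAction L r)
    (h : (α_ L.X L.X W).hom ≫ L.X ◁ r ≫ l =
      (β_ L.X L.X).hom ▷ W ≫ (α_ L.X L.X W).hom ≫ L.X ◁ l ≫ r) : IsLieAction L (l + r) := by
  have h' : (β_ L.X L.X).hom ▷ W ≫ (α_ L.X L.X W).hom ≫ L.X ◁ r ≫ l =
      (α_ L.X L.X W).hom ≫ L.X ◁ l ≫ r := by
    rw [h, ← comp_whiskerRight_assoc, SymmetricCategory.symmetry, id_whiskerRight,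
      Category.id_comp]
  rw [isLieAction_iff] at hl hr ⊢
  rw [Preadditive.comp_add, hl, hr]
  simp only [MonoidalPreadditive.whiskerLeft_add, Preadditive.comp_add, Preadditive.add_comp, h']
  rw [h]
  abel

theorem lieDefect_actLeft {X : C} (a : L.X ⊗ X ⟶ X) (Y : C) :
    lieDefect L (actLeft a Y) = (α_ _ _ _).inv ≫ lieDefect L a ▷ Y := by
  simp only [lieDefect, actLeft, sub_whiskerRight, Preadditive.comp_sub]
  congr 1
  · simp
  · congr 1 <;> simp

theorem lieDefect_actRight {Y : C} (X : C) (a : L.X ⊗ Y ⟶ Y) :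
    lieDefect L (actRight X a) =
      (L.X ⊗ L.X) ◁ (β_ X Y).hom ≫ ((α_ _ _ _).inv ≫ lieDefect L a ▷ X) ≫ (β_ Y X).hom := by
  have := lieDefect_conj (L := L) (actLeft a X) (β_ X Y)
  rwa [← SymmetricCategory.braiding_swap_eq_inv_braiding, ← actRight_eq, lieDefect_actLeft] at this

theorem isLieAction_actLeft {X : C} {a : L.X ⊗ X ⟶ X} (h : IsLieAction L a) (Y : C) :
    IsLieAction L (actLeft a Y) := by
  rw [IsLieAction, lieDefect_actLeft, h, MonoidalPreadditive.zero_whiskerRight, comp_zero]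

theorem isLieAction_actRight {Y : C} {a : L.X ⊗ Y ⟶ Y} (h : IsLieAction L a) (X : C) :
    IsLieAction L (actRight X a) := by
  rw [IsLieAction, lieDefect_actRight, h, MonoidalPreadditive.zero_whiskerRight, comp_zero,
    zero_comp, comp_zero]

/-- The action on a tensor product. -/
def tensorAct {B X Y : C} (a : B ⊗ X ⟶ X) (a' : B ⊗ Y ⟶ Y) : B ⊗ (X ⊗ Y) ⟶ X ⊗ Y :=
  actLeft a Y + actRight X a'

theorem IsLieAction.tensor {X Y : C} {a : L.X ⊗ X ⟶ X} {a' : L.X ⊗ Y ⟶ Y} (h : IsLieAction L a)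
    (h' : IsLieAction L a') : IsLieAction L (tensorAct a a') :=
  (isLieAction_actLeft h Y).add (isLieAction_actRight h' X) (actRight_actLeft a a')

end LieAction

section Equivariant

variable {C : Type u} [Category.{v} C] [MonoidalCategory C]

/-- The morphism `f` is equivariant for the operators `a` and `a'`. -/
def IsEquivariant {B X Y : C} (a : B ⊗ X ⟶ X) (a' : B ⊗ Y ⟶ Y) (f : X ⟶ Y) : Prop :=
  a ≫ f = B ◁ f ≫ a'

namespace IsEquivariant

variable {B X Y Z : C} {a : B ⊗ X ⟶ X} {a' : B ⊗ Y ⟶ Y} {a'' : B ⊗ Z ⟶ Z}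

theorem id (a : B ⊗ X ⟶ X) : IsEquivariant a a (𝟙 X) := by simp [IsEquivariant]

theorem comp {f : X ⟶ Y} {g : Y ⟶ Z} (hf : IsEquivariant a a' f) (hg : IsEquivariant a' a'' g) :
    IsEquivariant a a'' (f ≫ g) := by
  rw [IsEquivariant, ← Category.assoc, hf, Category.assoc, hg, whiskerLeft_comp, Category.assoc]

theorem inv {e : X ≅ Y} (h : IsEquivariant a a' e.hom) : IsEquivariant a' a e.inv := by
  rw [IsEquivariant, ← cancel_mono e.hom, Category.assoc, Category.assoc, h]
  simp

variable [Preadditive C] [MonoidalPreadditive C]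

theorem zero (a : B ⊗ X ⟶ X) (a' : B ⊗ Y ⟶ Y) : IsEquivariant a a' 0 := by simp [IsEquivariant]

theorem add {f g : X ⟶ Y} (hf : IsEquivariant a a' f) (hg : IsEquivariant a a' g) :
    IsEquivariant a a' (f + g) := by
  rw [IsEquivariant, Preadditive.comp_add, hf, hg, MonoidalPreadditive.whiskerLeft_add,
    Preadditive.add_comp]

variable [SymmetricCategory C]

omit [MonoidalPreadditive C] in
theorem tensorHom {X' Y' : C} {b : B ⊗ X' ⟶ X'} {b' : B ⊗ Y' ⟶ Y'} {f : X ⟶ Y} {g : X' ⟶ Y'}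
    (hf : IsEquivariant a a' f) (hg : IsEquivariant b b' g) :
    IsEquivariant (tensorAct a b) (tensorAct a' b') (f ⊗ₘ g) := by
  have hf' : a ≫ f = _ := hf
  have hg' : b ≫ g = _ := hg
  have h1 : actLeft a X' ≫ (f ⊗ₘ g) = B ◁ (f ⊗ₘ g) ≫ actLeft a' Y' := by
    simp only [actLeft, Category.assoc, MonoidalCategory.tensorHom_def,
      ← comp_whiskerRight_assoc, hf']
    rw [comp_whiskerRight, Category.assoc, ← whisker_exchange]
    simp
  have h2 : actRight X b ≫ (f ⊗ₘ g) = B ◁ (f ⊗ₘ g) ≫ actRight Y b' := by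
    simp only [actRight, Category.assoc, tensorHom_def', ← whiskerLeft_comp_assoc, hg']
    simp only [whiskerLeft_comp, Category.assoc, whisker_exchange]
    rw [whisker_exchange_assoc, ← associator_naturality_left_assoc, ← comp_whiskerRight_assoc,
      ← BraidedCategory.braiding_naturality_right, comp_whiskerRight, Category.assoc,
      associator_inv_naturality_right_assoc, whisker_exchange_assoc,
      associator_naturality_right_assoc, associator_inv_naturality_middle_assoc]
  rw [IsEquivariant, tensorAct, tensorAct, Preadditive.add_comp, h1, h2, Preadditive.comp_add]

omit [MonoidalPreadditive C] in
theorem braiding (a : B ⊗ X ⟶ X) (a' : B ⊗ Y ⟶ Y) :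
    IsEquivariant (tensorAct a a') (tensorAct a' a) (β_ X Y).hom := by
  rw [IsEquivariant, tensorAct, tensorAct, Preadditive.add_comp, Preadditive.comp_add,
    whiskerLeft_braiding_actLeft, whiskerLeft_braiding_actRight, add_comm]

theorem associator (a : B ⊗ X ⟶ X) (a' : B ⊗ Y ⟶ Y) (a'' : B ⊗ Z ⟶ Z) :
    IsEquivariant (tensorAct (tensorAct a a') a'') (tensorAct a (tensorAct a' a''))
      (α_ X Y Z).hom := by
  have h1 : actLeft (actLeft a Y) Z ≫ (α_ X Y Z).hom =
      B ◁ (α_ X Y Z).hom ≫ actLeft a (Y ⊗ Z) := by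
    simp [actLeft]
  have h2 : actLeft (actRight X a') Z ≫ (α_ X Y Z).hom =
      B ◁ (α_ X Y Z).hom ≫ actRight X (actLeft a' Z) := by
    simp [actLeft, actRight]
  have h3 : actRight (X ⊗ Y) a'' ≫ (α_ X Y Z).hom =
      B ◁ (α_ X Y Z).hom ≫ actRight X (actRight Y a'') := by
    simp only [actRight, BraidedCategory.braiding_tensor_right_hom]
    simp
  have h4 : actLeft (tensorAct a a') Z = actLeft (actLeft a Y) Z + actLeft (actRight X a') Z := by
    simp [actLeft, tensorAct]
  have h5 : actRight X (tensorAct a' a'') =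
      actRight X (actLeft a' Z) + actRight X (actRight Y a'') := by
    simp [actRight, tensorAct]
  rw [IsEquivariant, tensorAct.eq_def (tensorAct a a') a'', tensorAct.eq_def a (tensorAct a' a''),
    h4, h5]
  simp only [Preadditive.add_comp, Preadditive.comp_add, h1, h2, h3]
  abel

theorem cyc (a : B ⊗ X ⟶ X) (a' : B ⊗ Y ⟶ Y) (a'' : B ⊗ Z ⟶ Z) :
    IsEquivariant (tensorAct a (tensorAct a' a'')) (tensorAct a'' (tensorAct a a'))
      (cyc X Y Z) :=
  (associator a a' a'').inv.comp (braiding _ _)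

end IsEquivariant

end Equivariant

section InternalHom

variable {C : Type u} [Category.{v} C] [Preadditive C] [MonoidalCategory C] [SymmetricCategory C]
  [MonoidalPreadditive C]

/-- An operator on `Z` is an action if it is adjoint to an action on `X` with respect to a pairing
`X ⊗ Z ⟶ Y` that separates morphisms to `Z`. -/
theorem IsLieAction.of_pairing {L : LieObj C} {X Y Z : C} {a : L.X ⊗ X ⟶ X} (ha : IsLieAction L a)
    {z : L.X ⊗ Z ⟶ Z} {h : X ⊗ Z ⟶ Y} (hz : tensorAct a z ≫ h = 0)
    (hh : ∀ {W : C} (f : W ⟶ Z), X ◁ f ≫ h = 0 → f = 0) : IsLieAction L z := by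
  have e : actRight X z ≫ h = -actLeft a Z ≫ h := by
    rw [tensorAct, Preadditive.add_comp] at hz
    exact eq_neg_of_add_eq_zero_right hz
  have hl := (isLieAction_iff _).1 (isLieAction_actLeft ha Z)
  have hc := actRight_actLeft a z
  have hc' : (β_ L.X L.X).hom ▷ _ ≫ (α_ _ _ _).hom ≫ L.X ◁ actRight X z ≫ actLeft a Z =
      (α_ _ _ _).hom ≫ L.X ◁ actLeft a Z ≫ actRight X z := by
    rw [hc, ← comp_whiskerRight_assoc, SymmetricCategory.symmetry, id_whiskerRight,
      Category.id_comp]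
  have hd : lieDefect L (actRight X z) ≫ h = 0 := by
    have e1 : (α_ _ _ _).hom ≫ L.X ◁ actRight X z ≫ actRight X z ≫ h =
        (β_ L.X L.X).hom ▷ _ ≫ (α_ _ _ _).hom ≫ L.X ◁ actLeft a Z ≫ actLeft a Z ≫ h := by
      have := hc =≫ h
      simp only [Category.assoc, e, Preadditive.comp_neg] at this ⊢
      rw [this, neg_neg]
    have e2 : (β_ L.X L.X).hom ▷ _ ≫ (α_ _ _ _).hom ≫ L.X ◁ actRight X z ≫ actRight X z ≫ h =
        (α_ _ _ _).hom ≫ L.X ◁ actLeft a Z ≫ actLeft a Z ≫ h := by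
      have := hc' =≫ h
      simp only [Category.assoc, e, Preadditive.comp_neg] at this ⊢
      rw [this, neg_neg]
    have e3 := hl =≫ h
    simp only [Preadditive.sub_comp, Category.assoc] at e3
    simp only [lieDefect, Preadditive.sub_comp, Category.assoc, e2]
    rw [e1, e, Preadditive.comp_neg, e3]
    abel
  rw [lieDefect_actRight] at hd
  simp only [Category.assoc, Preadditive.IsIso.comp_left_eq_zero] at hd
  rw [BraidedCategory.braiding_naturality_left_assoc, Preadditive.IsIso.comp_left_eq_zero] at hd
  exact hh _ hd

variable [MonoidalClosed C]

open MonoidalClosed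

/-- The contragredient action on an internal hom object. -/
noncomputable def homAct {B X : C} (a : B ⊗ X ⟶ X) (Y : C) :
    B ⊗ (ihom X).obj Y ⟶ (ihom X).obj Y :=
  curry (-((α_ X B _).inv ≫ (β_ X B).hom ▷ _ ≫ a ▷ _ ≫ (ihom.ev X).app Y))

omit [MonoidalPreadditive C] in
/-- Currying identifies invariant pairings and equivariant morphisms. -/
theorem tensorAct_comp_eq_zero_iff {B X Y Z : C} (a : B ⊗ X ⟶ X) (z : B ⊗ Z ⟶ Z) (h : X ⊗ Z ⟶ Y) :
    tensorAct a z ≫ h = 0 ↔ IsEquivariant z (homAct a Y) (curry h) := by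
  have e1 : uncurry (B ◁ curry h ≫ homAct a Y) =
      -((α_ X B _).inv ≫ (β_ X B).hom ▷ _ ≫ a ▷ _ ≫ h) := by
    rw [uncurry_natural_left, homAct, uncurry_curry, Preadditive.comp_neg]
    congr 1
    have : h = X ◁ curry h ≫ (ihom.ev X).app Y := by
      rw [← uncurry_eq, uncurry_curry]
    conv_rhs => rw [this]
    rw [← whisker_exchange_assoc, ← whisker_exchange_assoc]
    simp
  have e2 : tensorAct a z ≫ h = (α_ B X Z).inv ≫ (β_ B X).hom ▷ Z ≫ (α_ X B Z).hom ≫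
      (X ◁ z ≫ h - -((α_ X B _).inv ≫ (β_ X B).hom ▷ _ ≫ a ▷ _ ≫ h)) := by
    rw [tensorAct, actLeft, actRight, sub_neg_eq_add, Preadditive.add_comp]
    simp only [Preadditive.comp_add, Category.assoc, Iso.hom_inv_id_assoc]
    rw [← comp_whiskerRight_assoc, SymmetricCategory.symmetry, id_whiskerRight, Category.id_comp,
      add_comm]
  rw [e2, Preadditive.IsIso.comp_left_eq_zero, Preadditive.IsIso.comp_left_eq_zero,
    Preadditive.IsIso.comp_left_eq_zero, sub_eq_zero, IsEquivariant, ← e1]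
  constructor
  · intro H
    apply uncurry_injective
    rw [← H, uncurry_natural_left, uncurry_curry]
  · intro H
    rw [← H, uncurry_natural_left, uncurry_curry]

theorem isLieAction_homAct {L : LieObj C} {X : C} {a : L.X ⊗ X ⟶ X} (ha : IsLieAction L a) (Y : C) :
    IsLieAction L (homAct a Y) := by
  refine ha.of_pairing (h := (ihom.ev X).app Y) ?_ fun {W} f hf => ?_
  · rw [tensorAct_comp_eq_zero_iff]
    have : curry ((ihom.ev X).app Y) = 𝟙 _ := by
      apply uncurry_injective
      rw [uncurry_curry, uncurry_eq, whiskerLeft_id, Category.id_comp]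
      rfl
    rw [this]
    exact IsEquivariant.id _
  · apply uncurry_injective
    rw [uncurry_eq, uncurry_eq, hf]
    simp

end InternalHom

section FreeModule

open MonoidalClosed

variable {C : Type u} [Category.{v} C] [MonoidalCategory C]

/-- The iterated tensor product `B ⊗ (B ⊗ ... ⊗ W)`. -/
@[reducible]
def iterTensor (B W : C) : ℕ → C
  | 0 => W
  | n + 1 => B ⊗ iterTensor B W n

/-- The iterated application of an operator to a generalized element. -/
def iterAct {B X W : C} (a : B ⊗ X ⟶ X) (x : W ⟶ X) : ∀ n, iterTensor B W n ⟶ X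
  | 0 => x
  | n + 1 => B ◁ iterAct a x n ≫ a

theorem IsEquivariant.iterAct_comp {B X Y W : C} {a : B ⊗ X ⟶ X} {a' : B ⊗ Y ⟶ Y} {f : X ⟶ Y}
    (hf : IsEquivariant a a' f) (x : W ⟶ X) (n : ℕ) :
    iterAct a x n ≫ f = iterAct a' (x ≫ f) n := by
  induction n with
  | zero => rfl
  | succ n ih => rw [iterAct, iterAct, Category.assoc, hf, ← ih, whiskerLeft_comp_assoc]

theorem whiskerLeft_cancel_of_epi [MonoidalClosed C] {A X Y Z : C} (e : X ⟶ Y) [Epi e]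
    {f g : A ⊗ Y ⟶ Z}
    (h : A ◁ e ≫ f = A ◁ e ≫ g) : f = g := by
  apply curry_injective
  rw [← cancel_epi e, ← curry_natural_left, h, curry_natural_left]

variable [HasColimitsOfShape (Discrete ℕ) C]

/-- The free object with an operator of `B` on one point. -/
noncomputable abbrev freeObj (B : C) : C := ∐ iterTensor B (𝟙_ C)

/-- The summands of the free object. -/
noncomputable def freeι (B : C) (n : ℕ) : iterTensor B (𝟙_ C) n ⟶ freeObj B :=
  Sigma.ι (iterTensor B (𝟙_ C)) n

theorem freeObj_hom_ext {B X : C} {f g : freeObj B ⟶ X} (h : ∀ n, freeι B n ≫ f = freeι B n ≫ g) :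
    f = g :=
  Sigma.hom_ext _ _ h

/-- The morphism from the free object induced by a point. -/
noncomputable def freeDesc {B X : C} (a : B ⊗ X ⟶ X) (x : 𝟙_ C ⟶ X) : freeObj B ⟶ X :=
  Limits.Sigma.desc (iterAct a x)

theorem freeι_freeDesc {B X : C} (a : B ⊗ X ⟶ X) (x : 𝟙_ C ⟶ X) (n : ℕ) :
    freeι B n ≫ freeDesc a x = iterAct a x n :=
  Sigma.ι_desc _ _

variable [MonoidalClosed C]

/-- The operator on the free object. -/
noncomputable def freeAct (B : C) : B ⊗ freeObj B ⟶ freeObj B :=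
  uncurry (Limits.Sigma.desc fun n => curry (freeι B (n + 1)))

theorem freeι_freeAct (B : C) (n : ℕ) : B ◁ freeι B n ≫ freeAct B = freeι B (n + 1) := by
  rw [freeAct, ← uncurry_natural_left, freeι, Sigma.ι_desc, uncurry_curry]

theorem tensor_freeObj_hom_ext {A B X : C} {f g : A ⊗ freeObj B ⟶ X}
    (h : ∀ n, A ◁ freeι B n ≫ f = A ◁ freeι B n ≫ g) : f = g := by
  apply curry_injective
  exact freeObj_hom_ext fun n => by rw [← curry_natural_left, ← curry_natural_left, h]

theorem freeDesc_isEquivariant {B X : C} (a : B ⊗ X ⟶ X) (x : 𝟙_ C ⟶ X) :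
    IsEquivariant (freeAct B) a (freeDesc a x) :=
  tensor_freeObj_hom_ext fun n => by
    rw [← Category.assoc, freeι_freeAct, freeι_freeDesc, ← whiskerLeft_comp_assoc, freeι_freeDesc,
      iterAct]

variable [Preadditive C] [SymmetricCategory C] [MonoidalPreadditive C] [HasCokernels C]
  (L : LieObj C)

/-- The relations of the enveloping algebra. -/
noncomputable def envRel : ∐ iterTensor L.X ((L.X ⊗ L.X) ⊗ freeObj L.X) ⟶ freeObj L.X :=
  Limits.Sigma.desc (iterAct (freeAct L.X) (lieDefect L (freeAct L.X)))

/-- The enveloping algebra of a Lie algebra. -/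
noncomputable def env : C := cokernel (envRel L)

/-- The projection from the free object to the enveloping algebra. -/
noncomputable def envπ : freeObj L.X ⟶ env L := cokernel.π (envRel L)

instance : Epi (envπ L) := inferInstanceAs (Epi (cokernel.π (envRel L)))

omit [MonoidalPreadditive C] in
theorem iterAct_envπ (n : ℕ) :
    iterAct (freeAct L.X) (lieDefect L (freeAct L.X)) n ≫ envπ L = 0 := by
  have h : envRel L ≫ envπ L = 0 := cokernel.condition _
  rw [← Sigma.ι_desc (iterAct (freeAct L.X) (lieDefect L (freeAct L.X))), ← envRel, Category.assoc,
    h, comp_zero]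

variable {L} in
/-- The morphism from the enveloping algebra induced by a morphism that respects the relations. -/
noncomputable def envDescOfRel {X : C} (f : freeObj L.X ⟶ X)
    (hf : ∀ n, iterAct (freeAct L.X) (lieDefect L (freeAct L.X)) n ≫ f = 0) : env L ⟶ X :=
  cokernel.desc _ f (Sigma.hom_ext _ _ fun n => by
    rw [comp_zero, envRel, Sigma.ι_desc_assoc, hf])

variable {L} in
omit [MonoidalPreadditive C] in
theorem envπ_envDescOfRel {X : C} (f : freeObj L.X ⟶ X)
    (hf : ∀ n, iterAct (freeAct L.X) (lieDefect L (freeAct L.X)) n ≫ f = 0) :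
    envπ L ≫ envDescOfRel f hf = f :=
  cokernel.π_desc _ _ _

/-- The action of a Lie algebra on its enveloping algebra by left multiplication. -/
noncomputable def envAct : L.X ⊗ env L ⟶ env L :=
  uncurry (envDescOfRel (curry (freeAct L.X ≫ envπ L)) fun n => by
    have h := iterAct_envπ L (n + 1)
    rw [iterAct, Category.assoc] at h
    rw [← curry_natural_left, h]
    apply uncurry_injective
    rw [uncurry_curry, uncurry_eq, MonoidalPreadditive.whiskerLeft_zero, zero_comp])

theorem envπ_isEquivariant : IsEquivariant (freeAct L.X) (envAct L) (envπ L) := by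
  rw [IsEquivariant, envAct, ← uncurry_natural_left, envπ_envDescOfRel, uncurry_curry]

theorem isLieAction_envAct : IsLieAction L (envAct L) := by
  apply whiskerLeft_cancel_of_epi (envπ L)
  rw [← lieDefect_naturality (envπ_isEquivariant L), comp_zero]
  exact iterAct_envπ L 0

/-- The unit of the enveloping algebra. -/
noncomputable def envUnit : 𝟙_ C ⟶ env L := freeι L.X 0 ≫ envπ L

variable {L}

theorem exists_env_hom {X : C} {a : L.X ⊗ X ⟶ X} (ha : IsLieAction L a) (x : 𝟙_ C ⟶ X) :
    ∃ f : env L ⟶ X, IsEquivariant (envAct L) a f ∧ envUnit L ≫ f = x := by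
  have h (n : ℕ) :
      iterAct (freeAct L.X) (lieDefect L (freeAct L.X)) n ≫ freeDesc a x = 0 := by
    rw [(freeDesc_isEquivariant a x).iterAct_comp,
      lieDefect_naturality (freeDesc_isEquivariant a x),
      ha, comp_zero]
    induction n with
    | zero => rfl
    | succ n ih => rw [iterAct, ih, MonoidalPreadditive.whiskerLeft_zero, zero_comp]
  refine ⟨envDescOfRel (freeDesc a x) h, ?_, ?_⟩
  · apply whiskerLeft_cancel_of_epi (envπ L)
    have := envπ_isEquivariant L
    rw [IsEquivariant] at this
    rw [← reassoc_of% this, ← whiskerLeft_comp_assoc, envπ_envDescOfRel,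
      freeDesc_isEquivariant]
  · rw [envUnit, Category.assoc, envπ_envDescOfRel, freeι_freeDesc, iterAct]

theorem env_hom_ext {X : C} {a : L.X ⊗ X ⟶ X} {f g : env L ⟶ X} (hf : IsEquivariant (envAct L) a f)
    (hg : IsEquivariant (envAct L) a g) (h : envUnit L ≫ f = envUnit L ≫ g) : f = g := by
  rw [← cancel_epi (envπ L)]
  refine freeObj_hom_ext fun n => ?_
  induction n with
  | zero => simpa only [envUnit, Category.assoc] using h
  | succ n ih =>
    have hf' := (envπ_isEquivariant L).comp hf
    have hg' := (envπ_isEquivariant L).comp hg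
    rw [IsEquivariant] at hf' hg'
    rw [← freeι_freeAct, Category.assoc, Category.assoc, hf', hg', ← whiskerLeft_comp_assoc, ih,
      whiskerLeft_comp_assoc]

end FreeModule

section Coinduced

open MonoidalClosed

variable {C : Type u} [Category.{v} C] [Preadditive C] [MonoidalCategory C] [SymmetricCategory C]
  [MonoidalPreadditive C] [MonoidalClosed C] [HasColimitsOfShape (Discrete ℕ) C] [HasCokernels C]
  (L : LieObj C)

/-- The underlying object of the cofree module on `Y`. -/
noncomputable abbrev cofree (Y : C) : C := (ihom (env L)).obj Y

/-- The action on the cofree module on `Y`. -/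
noncomputable def cofreeAct (Y : C) : L.X ⊗ cofree L Y ⟶ cofree L Y := homAct (envAct L) Y

theorem isLieAction_cofreeAct (Y : C) : IsLieAction L (cofreeAct L Y) :=
  isLieAction_homAct (isLieAction_envAct L) Y

/-- The evaluation of the cofree module at the unit. -/
noncomputable def cofreeEv (Y : C) : cofree L Y ⟶ Y :=
  (λ_ _).inv ≫ envUnit L ▷ _ ≫ (ihom.ev (env L)).app Y

variable {L}

omit [MonoidalPreadditive C] in
theorem envUnit_comp_uncurry {X Y : C} (k : X ⟶ cofree L Y) :
    envUnit L ▷ X ≫ uncurry k = (λ_ X).hom ≫ k ≫ cofreeEv L Y := by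
  rw [cofreeEv, ← leftUnitor_naturality_assoc, Iso.hom_inv_id_assoc, whisker_exchange_assoc,
    uncurry_eq]

/-- The morphism `env L ⟶ [X, Y]` obtained from `X ⟶ [env L, Y]` by swapping the arguments. -/
noncomputable def cofreeSwap {X Y : C} (k : X ⟶ cofree L Y) : env L ⟶ (ihom X).obj Y :=
  curry ((β_ _ _).hom ≫ uncurry k)

theorem cofreeSwap_isEquivariant {X Y : C} {a : L.X ⊗ X ⟶ X} (k : X ⟶ cofree L Y) :
    IsEquivariant (envAct L) (homAct a Y) (cofreeSwap k) ↔ IsEquivariant a (cofreeAct L Y) k := by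
  rw [cofreeSwap, ← tensorAct_comp_eq_zero_iff, ← Category.assoc, IsEquivariant.braiding,
    Category.assoc, Preadditive.IsIso.comp_left_eq_zero, tensorAct_comp_eq_zero_iff, curry_uncurry,
    cofreeAct]

omit [MonoidalPreadditive C] in
theorem envUnit_cofreeSwap {X Y : C} (k : X ⟶ cofree L Y) :
    envUnit L ≫ cofreeSwap k = curry ((ρ_ X).hom ≫ k ≫ cofreeEv L Y) := by
  rw [cofreeSwap, ← curry_natural_left, BraidedCategory.braiding_naturality_right_assoc,
    envUnit_comp_uncurry]
  simp

theorem cofree_hom_ext {X Y : C} {a : L.X ⊗ X ⟶ X} {k k' : X ⟶ cofree L Y}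
    (hk : IsEquivariant a (cofreeAct L Y) k) (hk' : IsEquivariant a (cofreeAct L Y) k')
    (h : k ≫ cofreeEv L Y = k' ≫ cofreeEv L Y) : k = k' := by
  have : cofreeSwap k = cofreeSwap k' :=
    env_hom_ext ((cofreeSwap_isEquivariant k).2 hk) ((cofreeSwap_isEquivariant k').2 hk')
      (by rw [envUnit_cofreeSwap, envUnit_cofreeSwap, h])
  exact uncurry_injective ((cancel_epi _).1 (curry_injective this))

theorem exists_cofree_hom {X Y : C} {a : L.X ⊗ X ⟶ X} (ha : IsLieAction L a) (g : X ⟶ Y) :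
    ∃ k : X ⟶ cofree L Y, IsEquivariant a (cofreeAct L Y) k ∧ k ≫ cofreeEv L Y = g := by
  obtain ⟨f, hf, hx⟩ := exists_env_hom (isLieAction_homAct ha Y) (curry ((ρ_ X).hom ≫ g))
  have e : cofreeSwap (L := L) (curry ((β_ _ _).hom ≫ uncurry f)) = f := by
    rw [cofreeSwap, uncurry_curry, SymmetricCategory.symmetry_assoc, curry_uncurry]
  refine ⟨curry ((β_ _ _).hom ≫ uncurry f), ?_, ?_⟩
  · rwa [← cofreeSwap_isEquivariant, e]
  · rw [← e, envUnit_cofreeSwap] at hx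
    exact (cancel_epi _).1 (curry_injective hx)

/-- Restriction of actions along a morphism of Lie algebras has a right adjoint. -/
theorem exists_coinduced [HasEqualizers C] {M : LieObj C} (q : M ⟶ L) {Y : C} (y : M.X ⊗ Y ⟶ Y) :
    ∃ (Z : C) (z : L.X ⊗ Z ⟶ Z) (ε : Z ⟶ Y), IsLieAction L z ∧
      IsEquivariant (q.hom ▷ Z ≫ z) y ε ∧
      ∀ {X : C} {a : L.X ⊗ X ⟶ X}, IsLieAction L a →
        (∀ g : X ⟶ Y, IsEquivariant (q.hom ▷ X ≫ a) y g → ∃ k, IsEquivariant a z k ∧ k ≫ ε = g) ∧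
        ∀ {k k' : X ⟶ Z}, IsEquivariant a z k → IsEquivariant a z k' → k ≫ ε = k' ≫ ε → k = k' := by
  obtain ⟨φ, hφ, hφ'⟩ := exists_cofree_hom (isLieAction_cofreeAct L Y)
    (curry (q.hom ▷ _ ≫ cofreeAct L Y ≫ cofreeEv L Y))
  obtain ⟨ψ, hψ, hψ'⟩ := exists_cofree_hom (isLieAction_cofreeAct L Y)
    (curry (M.X ◁ cofreeEv L Y ≫ y))
  have hz : (L.X ◁ equalizer.ι φ ψ ≫ cofreeAct L Y) ≫ φ =
      (L.X ◁ equalizer.ι φ ψ ≫ cofreeAct L Y) ≫ ψ := by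
    rw [Category.assoc, Category.assoc, hφ, hψ, ← whiskerLeft_comp_assoc, equalizer.condition,
      whiskerLeft_comp_assoc]
  have he : IsEquivariant (equalizer.lift _ hz) (cofreeAct L Y) (equalizer.ι φ ψ) :=
    equalizer.lift_ι _ _
  have key {X : C} {a : L.X ⊗ X ⟶ X} {k : X ⟶ cofree L Y} (hk : IsEquivariant a (cofreeAct L Y) k) :
      k ≫ φ = k ≫ ψ ↔ IsEquivariant (q.hom ▷ X ≫ a) y (k ≫ cofreeEv L Y) := by
    have e1 : k ≫ φ ≫ cofreeEv L _ = curry ((q.hom ▷ X ≫ a) ≫ k ≫ cofreeEv L Y) := by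
      rw [hφ', ← curry_natural_left, whisker_exchange_assoc, ← Category.assoc (L.X ◁ k), ← hk]
      simp
    have e2 : k ≫ ψ ≫ cofreeEv L _ = curry (M.X ◁ (k ≫ cofreeEv L Y) ≫ y) := by
      rw [hψ', ← curry_natural_left, whiskerLeft_comp_assoc]
    rw [IsEquivariant, ← curry_injective.eq_iff, ← e1, ← e2]
    refine ⟨fun h => by rw [reassoc_of% h], fun h => cofree_hom_ext (hk.comp hφ) (hk.comp hψ) ?_⟩
    simpa using h
  refine ⟨equalizer φ ψ, equalizer.lift _ hz, equalizer.ι φ ψ ≫ cofreeEv L Y,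
    (isLieAction_cofreeAct L Y).of_mono _ he, (key he).1 (equalizer.condition φ ψ), fun ha =>
    ⟨fun g hg => ?_, fun {k k'} hk hk' h => ?_⟩⟩
  · obtain ⟨k, hk, rfl⟩ := exists_cofree_hom ha g
    refine ⟨equalizer.lift k ((key hk).2 hg), ?_, by rw [equalizer.lift_ι_assoc]⟩
    rw [IsEquivariant, ← cancel_mono (equalizer.ι φ ψ), Category.assoc, Category.assoc, he,
      ← whiskerLeft_comp_assoc, equalizer.lift_ι, hk]
  · rw [← cancel_mono (equalizer.ι φ ψ)]
    exact cofree_hom_ext (hk.comp he) (hk'.comp he) (by simpa using h)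

end Coinduced

section LieModuleAlgebra

variable {C : Type u} [Category.{v} C] [Preadditive C] [MonoidalCategory C] [SymmetricCategory C]

/-- A Lie algebra on which the Lie algebra `L` acts by derivations. -/
structure LieModuleAlgebra (L : LieObj C) where
  /-- the Lie algebra -/
  alg : LieObj C
  /-- the action -/
  act : L.X ⊗ alg.X ⟶ alg.X
  isLieAction : IsLieAction L act
  derivation : IsEquivariant (tensorAct act act) act alg.bracket

namespace LieModuleAlgebra

/-- A morphism of Lie algebras that is equivariant. -/
@[ext]
structure Hom {L : LieObj C} (P Q : LieModuleAlgebra L) where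
  /-- the underlying morphism of Lie algebras -/
  hom : P.alg ⟶ Q.alg
  isEquivariant : IsEquivariant P.act Q.act hom.hom

instance (L : LieObj C) : Category.{v} (LieModuleAlgebra L) where
  Hom P Q := Hom P Q
  id P := ⟨𝟙 P.alg, IsEquivariant.id _⟩
  comp f g := ⟨f.hom ≫ g.hom, f.isEquivariant.comp g.isEquivariant⟩
  id_comp f := Hom.ext (Category.id_comp f.hom)
  comp_id f := Hom.ext (Category.comp_id f.hom)
  assoc f g h := Hom.ext (Category.assoc f.hom g.hom h.hom)

variable {L : LieObj C}

theorem hom_ext {P Q : LieModuleAlgebra L} {f g : P ⟶ Q} (h : f.hom.hom = g.hom.hom) : f = g :=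
  Hom.ext (LieObj.hom_ext h)

@[simp] theorem id_hom (P : LieModuleAlgebra L) : Hom.hom (𝟙 P) = 𝟙 P.alg := rfl

@[simp] theorem comp_hom {P Q R : LieModuleAlgebra L} (f : P ⟶ Q) (g : Q ⟶ R) :
    (f ≫ g).hom = f.hom ≫ g.hom := rfl

end LieModuleAlgebra

theorem tensorAct_restrict [MonoidalPreadditive C] {B B' X Y : C} (f : B' ⟶ B) (a : B ⊗ X ⟶ X)
    (a' : B ⊗ Y ⟶ Y) : tensorAct (f ▷ X ≫ a) (f ▷ Y ≫ a') = f ▷ (X ⊗ Y) ≫ tensorAct a a' := by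
  have h1 : actLeft (f ▷ X ≫ a) Y = f ▷ (X ⊗ Y) ≫ actLeft a Y := by simp [actLeft]
  have h2 : actRight X (f ▷ Y ≫ a') = f ▷ (X ⊗ Y) ≫ actRight X a' := by
    simp only [actRight, whiskerLeft_comp]
    rw [← associator_naturality_middle_assoc, ← comp_whiskerRight_assoc,
      ← BraidedCategory.braiding_naturality_left, comp_whiskerRight, Category.assoc,
      associator_inv_naturality_left_assoc]
  rw [tensorAct, tensorAct, h1, h2, Preadditive.comp_add]

omit [Preadditive C] [SymmetricCategory C] in
theorem IsEquivariant.restrict {B B' X Y : C} {a : B ⊗ X ⟶ X} {a' : B ⊗ Y ⟶ Y} {g : X ⟶ Y}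
    (h : IsEquivariant a a' g) (f : B' ⟶ B) : IsEquivariant (f ▷ X ≫ a) (f ▷ Y ≫ a') g := by
  rw [IsEquivariant, Category.assoc, h, whisker_exchange_assoc]

namespace LieModuleAlgebra

variable [MonoidalPreadditive C] {L M : LieObj C}

/-- Restriction of an action along a morphism of Lie algebras. -/
abbrev restrictObj (q : M ⟶ L) (P : LieModuleAlgebra L) : LieModuleAlgebra M where
  alg := P.alg
  act := q.hom ▷ _ ≫ P.act
  isLieAction := P.isLieAction.restrict q
  derivation := by
    rw [tensorAct_restrict]
    exact P.derivation.restrict q.hom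

/-- Restriction of actions is functorial. -/
abbrev restrictMap (q : M ⟶ L) {P Q : LieModuleAlgebra L} (f : P ⟶ Q) :
    restrictObj q P ⟶ restrictObj q Q :=
  ⟨f.hom, f.isEquivariant.restrict q.hom⟩

/-- Restriction of actions along a morphism of Lie algebras. -/
@[simps]
def restrict (q : M ⟶ L) : LieModuleAlgebra L ⥤ LieModuleAlgebra M where
  obj P := restrictObj q P
  map f := restrictMap q f

variable [MonoidalClosed C] [HasColimitsOfShape (Discrete ℕ) C] [HasCokernels C] [HasEqualizers C]

open IsEquivariant in
/-- The Lie algebra coinduced along a morphism of Lie algebras. -/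
theorem exists_terminal_restrict (q : M ⟶ L) (Y : LieModuleAlgebra M) :
    ∃ (Z : LieModuleAlgebra L) (ε : (restrict q).obj Z ⟶ Y),
      ∀ {X : LieModuleAlgebra L} (g : (restrict q).obj X ⟶ Y),
        (∃ k : X ⟶ Z, (restrict q).map k ≫ ε = g) ∧
        ∀ k k' : X ⟶ Z, (restrict q).map k ≫ ε = (restrict q).map k' ≫ ε → k = k' := by
  obtain ⟨Z, z, ε, hz, hε, huniv⟩ := exists_coinduced q Y.act
  have hzz := hz.tensor hz
  obtain ⟨b, hb, hbε⟩ := (huniv hzz).1 ((ε ⊗ₘ ε) ≫ Y.alg.bracket) (by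
    rw [← tensorAct_restrict]
    exact (hε.tensorHom hε).comp Y.derivation)
  have hbr {P Q : C} {a : L.X ⊗ P ⟶ P} {a' : L.X ⊗ Q ⟶ Q} {f : P ⟶ Z} {g : Q ⟶ Z}
      (hf : IsEquivariant a z f) (hg : IsEquivariant a' z g) :
      IsEquivariant (tensorAct a a') z (brk b f g) := (hf.tensorHom hg).comp hb
  have hi := IsEquivariant.id z
  let A : LieObj C :=
    { X := Z
      bracket := b
      antisymm := by
        refine (huniv hzz).2 (((IsEquivariant.id _).add (braiding _ _)).comp hb) (zero _ _) ?_
        rw [zero_comp, Category.assoc, hbε, Preadditive.add_comp, Category.id_comp,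
          ← BraidedCategory.braiding_naturality_assoc, Y.alg.isSkew, Preadditive.comp_neg,
          add_neg_cancel]
      jacobi := by
        rw [← jac_id]
        refine (huniv (hz.tensor hzz)).2 (((hbr hi (hbr hi hi)).add ((IsEquivariant.cyc _ _ _).comp
          (hbr hi (hbr hi hi)))).add
          (((IsEquivariant.cyc _ _ _).comp (IsEquivariant.cyc _ _ _)).comp (hbr hi (hbr hi hi))))
          (zero _ _) ?_
        rw [LieObj.jac_comp hbε, Y.alg.jac_eq_zero, zero_comp] }
  refine ⟨⟨A, z, hz, hb⟩, ⟨⟨ε, hbε⟩, hε⟩, fun {X} g => ⟨?_, fun k k' h => hom_ext ?_⟩⟩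
  · obtain ⟨k, hk, hkε⟩ := (huniv X.isLieAction).1 g.hom.hom g.isEquivariant
    refine ⟨⟨⟨k, ?_⟩, hk⟩, hom_ext hkε⟩
    refine (huniv (X.isLieAction.tensor X.isLieAction)).2 (X.derivation.comp hk)
      ((hk.tensorHom hk).comp hb) ?_
    rw [Category.assoc, hkε, Category.assoc, hbε, tensorHom_comp_tensorHom_assoc, hkε]
    exact g.hom.map_bracket
  · exact (huniv X.isLieAction).2 k.isEquivariant k'.isEquivariant
      (congrArg (fun f => f.hom.hom) h)

instance (q : M ⟶ L) : (restrict q).IsLeftAdjoint := by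
  have (Y : LieModuleAlgebra M) : HasTerminal (CostructuredArrow (restrict q) Y) := by
    obtain ⟨Z, ε, h⟩ := exists_terminal_restrict q Y
    refine (IsTerminal.ofUniqueHom (Y := CostructuredArrow.mk ε)
      (fun X => CostructuredArrow.homMk (h X.hom).1.choose (h X.hom).1.choose_spec)
      fun X m => ?_).hasTerminal
    ext1
    exact (h X.hom).2 _ _ ((CostructuredArrow.w m).trans (h X.hom).1.choose_spec.symm)
  exact isLeftAdjoint_of_costructuredArrowTerminals _

end LieModuleAlgebra

end LieModuleAlgebra

section SemidirectProduct

variable {C : Type u} [Category.{v} C] [Preadditive C] [MonoidalCategory C] [SymmetricCategory C]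
  [MonoidalPreadditive C] [HasBinaryBiproducts C]

omit [SymmetricCategory C] in
theorem biprod_whiskerRight_hom_ext {X Y W Z : C} {f g : (X ⊞ Y) ⊗ W ⟶ Z}
    (hl : biprod.inl ▷ W ≫ f = biprod.inl ▷ W ≫ g) (hr : biprod.inr ▷ W ≫ f = biprod.inr ▷ W ≫ g) :
    f = g := by
  have h : 𝟙 ((X ⊞ Y) ⊗ W) = biprod.fst ▷ W ≫ biprod.inl ▷ W + biprod.snd ▷ W ≫ biprod.inr ▷ W := by
    rw [← comp_whiskerRight, ← comp_whiskerRight, ← MonoidalPreadditive.add_whiskerRight,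
      biprod.total, id_whiskerRight]
  rw [← Category.id_comp f, ← Category.id_comp g, h]
  simp only [Preadditive.add_comp, Category.assoc, hl, hr]

theorem biprod_whiskerLeft_hom_ext {X Y W Z : C} {f g : W ⊗ (X ⊞ Y) ⟶ Z}
    (hl : W ◁ biprod.inl ≫ f = W ◁ biprod.inl ≫ g) (hr : W ◁ biprod.inr ≫ f = W ◁ biprod.inr ≫ g) :
    f = g := by
  rw [← cancel_epi (β_ (X ⊞ Y) W).hom]
  apply biprod_whiskerRight_hom_ext
  · rw [BraidedCategory.braiding_naturality_left_assoc, hl,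
      BraidedCategory.braiding_naturality_left_assoc]
  · rw [BraidedCategory.braiding_naturality_left_assoc, hr,
      BraidedCategory.braiding_naturality_left_assoc]

theorem biprod_tensor_hom_ext {X Y Z : C} {f g : (X ⊞ Y) ⊗ (X ⊞ Y) ⟶ Z}
    (h₁ : (biprod.inl ⊗ₘ biprod.inl) ≫ f = (biprod.inl ⊗ₘ biprod.inl) ≫ g)
    (h₂ : (biprod.inl ⊗ₘ biprod.inr) ≫ f = (biprod.inl ⊗ₘ biprod.inr) ≫ g)
    (h₃ : (biprod.inr ⊗ₘ biprod.inl) ≫ f = (biprod.inr ⊗ₘ biprod.inl) ≫ g)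
    (h₄ : (biprod.inr ⊗ₘ biprod.inr) ≫ f = (biprod.inr ⊗ₘ biprod.inr) ≫ g) : f = g := by
  simp only [tensorHom_def', Category.assoc] at h₁ h₂ h₃ h₄
  exact biprod_whiskerRight_hom_ext (biprod_whiskerLeft_hom_ext h₁ h₂)
    (biprod_whiskerLeft_hom_ext h₃ h₄)

theorem jac_biprod {A P P' Q R : C} {b : A ⊗ A ⟶ A} {f : P ⊞ P' ⟶ A} {g : Q ⟶ A} {h : R ⟶ A}
    (h₁ : jac b (biprod.inl ≫ f) g h = 0) (h₂ : jac b (biprod.inr ≫ f) g h = 0) :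
    jac b f g h = 0 := by
  have key {P₀ : C} (k : P₀ ⟶ P ⊞ P') : jac b (k ≫ f) g h = k ▷ (Q ⊗ R) ≫ jac b f g h := by
    rw [jac_eq_tensorHom_comp, jac_eq_tensorHom_comp b f, ← tensorHom_id,
      tensorHom_comp_tensorHom_assoc, Category.id_comp]
  rw [key] at h₁ h₂
  apply biprod_whiskerRight_hom_ext
  · rw [h₁, comp_zero]
  · rw [h₂, comp_zero]

theorem jac_biprod_id {X Y : C} {b : (X ⊞ Y) ⊗ (X ⊞ Y) ⟶ X ⊞ Y}
    (lll : jac b biprod.inl biprod.inl biprod.inl = 0)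
    (llr : jac b biprod.inl biprod.inl biprod.inr = 0)
    (lrr : jac b biprod.inl biprod.inr biprod.inr = 0)
    (rrr : jac b biprod.inr biprod.inr biprod.inr = 0) : jac b (𝟙 _) (𝟙 _) (𝟙 _) = 0 := by
  have s₁ {Q R : C} {g : Q ⟶ X ⊞ Y} {h : R ⟶ X ⊞ Y} (h₁ : jac b biprod.inl g h = 0)
      (h₂ : jac b biprod.inr g h = 0) : jac b (𝟙 _) g h = 0 :=
    jac_biprod (by rwa [Category.comp_id]) (by rwa [Category.comp_id])
  have s₂ {Q R : C} {g : Q ⟶ X ⊞ Y} {h : R ⟶ X ⊞ Y} (h₁ : jac b g biprod.inl h = 0)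
      (h₂ : jac b g biprod.inr h = 0) : jac b g (𝟙 _) h = 0 :=
    jac_rotate (s₁ (jac_rotate (jac_rotate h₁)) (jac_rotate (jac_rotate h₂)))
  have s₃ {Q R : C} {g : Q ⟶ X ⊞ Y} {h : R ⟶ X ⊞ Y} (h₁ : jac b g h biprod.inl = 0)
      (h₂ : jac b g h biprod.inr = 0) : jac b g h (𝟙 _) = 0 :=
    jac_rotate (jac_rotate (s₁ (jac_rotate h₁) (jac_rotate h₂)))
  exact s₁ (s₂ (s₃ lll llr) (s₃ (jac_rotate (jac_rotate llr)) lrr))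
    (s₂ (s₃ (jac_rotate llr) (jac_rotate lrr)) (s₃ (jac_rotate (jac_rotate lrr)) rrr))

omit [MonoidalPreadditive C] [HasBinaryBiproducts C] in
theorem IsSkew.brk_comp_swap {A A' P Q : C} {b : A ⊗ A ⟶ A} {b' : A' ⊗ A' ⟶ A'} (hb : IsSkew b)
    (hb' : IsSkew b') {k : A ⟶ A'} {f : P ⟶ A} {g : Q ⟶ A}
    (h : brk b f g ≫ k = brk b' (f ≫ k) (g ≫ k)) : brk b g f ≫ k = brk b' (g ≫ k) (f ≫ k) := by
  rw [← cancel_epi (β_ P Q).hom, ← Category.assoc, hb.braiding_brk, hb'.braiding_brk,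
    Preadditive.neg_comp, h]

/-- A morphism from a biproduct preserves a skew bracket if it does so on the summands. -/
theorem biprod_map_bracket {X Y A : C} {b : (X ⊞ Y) ⊗ (X ⊞ Y) ⟶ X ⊞ Y} {b' : A ⊗ A ⟶ A}
    (hb : IsSkew b) (hb' : IsSkew b') {k : X ⊞ Y ⟶ A}
    (h₁ : brk b biprod.inl biprod.inl ≫ k = brk b' (biprod.inl ≫ k) (biprod.inl ≫ k))
    (h₂ : brk b biprod.inl biprod.inr ≫ k = brk b' (biprod.inl ≫ k) (biprod.inr ≫ k))
    (h₃ : brk b biprod.inr biprod.inr ≫ k = brk b' (biprod.inr ≫ k) (biprod.inr ≫ k)) :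
    b ≫ k = (k ⊗ₘ k) ≫ b' := by
  have h₂' := hb.brk_comp_swap hb' h₂
  simp only [brk, Category.assoc, ← tensorHom_comp_tensorHom] at h₁ h₂ h₂' h₃
  exact biprod_tensor_hom_ext h₁ h₂ h₂' h₃

omit [Preadditive C] [SymmetricCategory C] [MonoidalPreadditive C] [HasBinaryBiproducts C] in
theorem brk_id {A : C} (b : A ⊗ A ⟶ A) : brk b (𝟙 A) (𝟙 A) = b := by simp [brk]

/-- An isomorphism of the total objects that is compatible with the structure is an isomorphism of
points. -/
def Pt.isoMk {D : Type u} [Category.{v} D] {B : D} {P Q : Pt B} (e : P.A ≅ Q.A)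
    (hp : e.hom ≫ Q.p = P.p) (hs : P.s ≫ e.hom = Q.s) : P ≅ Q where
  hom := ⟨e.hom, hp, hs⟩
  inv := ⟨e.inv, by rw [← hp, e.inv_hom_id_assoc], by
    rw [← hs, Category.assoc, e.hom_inv_id, Category.comp_id]⟩
  hom_inv_id := Pt.Hom.ext e.hom_inv_id
  inv_hom_id := Pt.Hom.ext e.inv_hom_id

namespace LieModuleAlgebra

variable {L M : LieObj C} (P Q : LieModuleAlgebra L)

/-- The bracket of the semidirect product. -/
noncomputable def semidirectBracket :
    (L.X ⊞ P.alg.X) ⊗ (L.X ⊞ P.alg.X) ⟶ L.X ⊞ P.alg.X :=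
  (biprod.fst ⊗ₘ biprod.fst) ≫ L.bracket ≫ biprod.inl +
    ((biprod.fst ⊗ₘ biprod.snd) ≫ P.act - (biprod.snd ⊗ₘ biprod.fst) ≫ (β_ _ _).hom ≫ P.act +
      (biprod.snd ⊗ₘ biprod.snd) ≫ P.alg.bracket) ≫ biprod.inr

omit [SymmetricCategory C] [HasBinaryBiproducts C] in
theorem tensorHom_zero {X Y X' Y' : C} (f : X' ⟶ Y') : (f ⊗ₘ (0 : X ⟶ Y)) = 0 := by
  simp [MonoidalCategory.tensorHom_def]

theorem semidirectBracket_inl_inl :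
    brk P.semidirectBracket biprod.inl biprod.inl = L.bracket ≫ biprod.inl := by
  simp [brk, semidirectBracket, tensorHom_zero]

theorem semidirectBracket_inl_inr :
    brk P.semidirectBracket biprod.inl biprod.inr = P.act ≫ biprod.inr := by
  simp [brk, semidirectBracket, tensorHom_zero]

theorem semidirectBracket_inr_inl :
    brk P.semidirectBracket biprod.inr biprod.inl = -(β_ _ _).hom ≫ P.act ≫ biprod.inr := by
  simp [brk, semidirectBracket, tensorHom_zero]

theorem semidirectBracket_inr_inr :
    brk P.semidirectBracket biprod.inr biprod.inr = P.alg.bracket ≫ biprod.inr := by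
  simp [brk, semidirectBracket, tensorHom_zero]

theorem isSkew_semidirectBracket : IsSkew P.semidirectBracket := by
  have key {X Y : C} (f : X ⟶ L.X ⊞ P.alg.X) (g : Y ⟶ L.X ⊞ P.alg.X)
      (h : (β_ X Y).hom ≫ brk P.semidirectBracket g f = -brk P.semidirectBracket f g) :
      (f ⊗ₘ g) ≫ (β_ _ _).hom ≫ P.semidirectBracket = (f ⊗ₘ g) ≫ (-P.semidirectBracket) := by
    rw [BraidedCategory.braiding_naturality_assoc, Preadditive.comp_neg]
    exact h
  apply biprod_tensor_hom_ext <;> apply key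
  · rw [semidirectBracket_inl_inl, ← Category.assoc, L.isSkew, Preadditive.neg_comp]
  · rw [semidirectBracket_inl_inr, semidirectBracket_inr_inl, Preadditive.comp_neg,
      SymmetricCategory.symmetry_assoc]
  · rw [semidirectBracket_inl_inr, semidirectBracket_inr_inl, neg_neg]
  · rw [semidirectBracket_inr_inr, ← Category.assoc, P.alg.isSkew, Preadditive.neg_comp]

theorem jac_semidirectBracket : jac P.semidirectBracket (𝟙 _) (𝟙 _) (𝟙 _) = 0 := by
  have hs := P.isSkew_semidirectBracket
  have hl : L.bracket ≫ biprod.inl = (biprod.inl ⊗ₘ biprod.inl) ≫ P.semidirectBracket :=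
    P.semidirectBracket_inl_inl.symm
  have hr : P.alg.bracket ≫ biprod.inr = (biprod.inr ⊗ₘ biprod.inr) ≫ P.semidirectBracket :=
    P.semidirectBracket_inr_inr.symm
  have lll : jac P.semidirectBracket biprod.inl biprod.inl biprod.inl = 0 := by
    have := LieObj.jac_comp hl (𝟙 _) (𝟙 _) (𝟙 _)
    rwa [L.jac_eq_zero, zero_comp, Category.id_comp, eq_comm] at this
  have rrr : jac P.semidirectBracket biprod.inr biprod.inr biprod.inr = 0 := by
    have := LieObj.jac_comp hr (𝟙 _) (𝟙 _) (𝟙 _)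
    rwa [P.alg.jac_eq_zero, zero_comp, Category.id_comp, eq_comm] at this
  have hL {X Y : C} (k : X ⟶ L.X) (k' : Y ⟶ P.alg.X) :
      brk P.semidirectBracket (k ≫ biprod.inl) (k' ≫ biprod.inr) =
        (k ⊗ₘ k') ≫ P.act ≫ biprod.inr := by
    rw [← semidirectBracket_inl_inr, tensorHom_comp_brk]
  have hR {X Y : C} (k : X ⟶ P.alg.X) (k' : Y ⟶ P.alg.X) :
      brk P.semidirectBracket (k ≫ biprod.inr) (k' ≫ biprod.inr) =
        (k ⊗ₘ k') ≫ P.alg.bracket ≫ biprod.inr := by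
    rw [← semidirectBracket_inr_inr, tensorHom_comp_brk]
  have hL' {X : C} (k : X ⟶ P.alg.X) := hL (𝟙 _) k
  have hR' {X : C} (k : X ⟶ P.alg.X) := hR (𝟙 _) k
  have hR'' {X : C} (k : X ⟶ P.alg.X) := hR k (𝟙 _)
  have hL'' {X : C} (k : X ⟶ L.X) := hL k (𝟙 _)
  rw [Category.id_comp] at hL' hR' hR'' hL''
  have llr : jac P.semidirectBracket biprod.inl biprod.inl biprod.inr = 0 := by
    rw [jac_eq_zero_iff hs, semidirectBracket_inl_inl, semidirectBracket_inl_inr, hL', hL'']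
    have := (isLieAction_iff _).1 P.isLieAction =≫ (biprod.inr : _ ⟶ L.X ⊞ P.alg.X)
    simpa using this
  have lrr : jac P.semidirectBracket biprod.inl biprod.inr biprod.inr = 0 := by
    rw [jac_eq_zero_iff hs, semidirectBracket_inr_inr, semidirectBracket_inl_inr, hL', hR', hR'']
    have := (α_ _ _ _).hom ≫= (P.derivation =≫ (biprod.inr : _ ⟶ L.X ⊞ P.alg.X))
    rw [tensorAct, actLeft, actRight] at this
    simp only [Preadditive.add_comp, Preadditive.comp_add, Category.assoc,
      Iso.hom_inv_id_assoc] at this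
    rw [eq_sub_iff_add_eq]
    simpa using this
  exact jac_biprod_id lll llr lrr rrr

/-- The semidirect product. -/
noncomputable abbrev semidirect : LieObj C where
  X := L.X ⊞ P.alg.X
  bracket := P.semidirectBracket
  antisymm := (isSkew_iff _).1 P.isSkew_semidirectBracket
  jacobi := by rw [← jac_id, P.jac_semidirectBracket]

/-- The morphism from a semidirect product given by its restrictions to the two factors. -/
noncomputable abbrev semidirectDesc {A : LieObj C} (u : L ⟶ A) (w : P.alg ⟶ A)
    (h : P.act ≫ w.hom = brk A.bracket u.hom w.hom) : P.semidirect ⟶ A where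
  hom := biprod.desc u.hom w.hom
  map_bracket := by
    apply biprod_map_bracket P.isSkew_semidirectBracket A.isSkew
    · rw [semidirectBracket_inl_inl, Category.assoc, biprod.inl_desc, u.map_bracket, brk]
    · rw [semidirectBracket_inl_inr, Category.assoc, biprod.inl_desc, biprod.inr_desc, h]
    · rw [semidirectBracket_inr_inr, Category.assoc, biprod.inr_desc, w.map_bracket, brk]

/-- The inclusion of the acting Lie algebra. -/
noncomputable abbrev semidirectInl : L ⟶ P.semidirect :=
  ⟨biprod.inl, P.semidirectBracket_inl_inl.symm⟩

/-- The inclusion of the kernel. -/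
noncomputable abbrev semidirectInr : P.alg ⟶ P.semidirect :=
  ⟨biprod.inr, P.semidirectBracket_inr_inr.symm⟩

/-- The projection to the acting Lie algebra. -/
noncomputable abbrev semidirectFst : P.semidirect ⟶ L where
  hom := biprod.fst
  map_bracket := by
    apply biprod_map_bracket P.isSkew_semidirectBracket L.isSkew
    · rw [semidirectBracket_inl_inl, Category.assoc, biprod.inl_fst, Category.comp_id, brk_id]
    · rw [semidirectBracket_inl_inr, Category.assoc, biprod.inr_fst, comp_zero, brk_zero]
    · rw [semidirectBracket_inr_inr, Category.assoc, biprod.inr_fst, comp_zero, brk_zero]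

/-- The semidirect product as a point. -/
noncomputable abbrev semidirectPt : Pt L where
  A := P.semidirect
  p := P.semidirectFst
  s := P.semidirectInl
  s_p := LieObj.hom_ext biprod.inl_fst

variable {P Q} in
/-- Semidirect products are functorial. -/
noncomputable abbrev semidirectMap (f : P ⟶ Q) : P.semidirect ⟶ Q.semidirect :=
  P.semidirectDesc Q.semidirectInl (f.hom ≫ Q.semidirectInr) (by
    have h : P.act ≫ f.hom.hom = L.X ◁ f.hom.hom ≫ Q.act := f.isEquivariant
    have := tensorHom_comp_brk Q.semidirectBracket biprod.inl biprod.inr (𝟙 _) f.hom.hom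
    rw [Category.id_comp] at this
    rw [LieObj.comp_hom, ← Category.assoc, h, ← this, semidirectBracket_inl_inr, id_tensorHom,
      Category.assoc])

variable {P Q} in
/-- Semidirect products as points are functorial. -/
noncomputable abbrev semidirectPtMap (f : P ⟶ Q) : P.semidirectPt ⟶ Q.semidirectPt where
  hom := semidirectMap f
  hom_p := LieObj.hom_ext (by
    dsimp
    apply biprod.hom_ext' <;> simp)
  s_hom := LieObj.hom_ext (by
    change biprod.inl ≫ biprod.desc biprod.inl (f.hom.hom ≫ biprod.inr) = biprod.inl
    simp)

/-- The semidirect product functor. -/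
noncomputable def semidirectFunctor (L : LieObj C) : LieModuleAlgebra L ⥤ Pt L where
  obj P := P.semidirectPt
  map f := semidirectPtMap f
  map_id P := Pt.Hom.ext (LieObj.hom_ext (by
    change biprod.desc biprod.inl (𝟙 P.alg.X ≫ biprod.inr) = 𝟙 (L.X ⊞ P.alg.X)
    apply biprod.hom_ext' <;> simp))
  map_comp {P Q R} f g := Pt.Hom.ext (LieObj.hom_ext (by
    change _ = (semidirectMap f).hom ≫ (semidirectMap g).hom
    apply biprod.hom_ext' <;> simp))

instance (L : LieObj C) : (semidirectFunctor L).Faithful where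
  map_injective {P Q f g} h := hom_ext (by
    have h' : (semidirectMap f).hom = (semidirectMap g).hom := congrArg (fun k => k.hom.hom) h
    have h'' := biprod.inr ≫= h' =≫ biprod.snd
    simpa using h'')

variable {P Q} in
theorem semidirect_inr_hom (f : P.semidirectPt ⟶ Q.semidirectPt) :
    biprod.inr ≫ f.hom.hom = (biprod.inr ≫ f.hom.hom ≫ biprod.snd) ≫ biprod.inr := by
  have h : f.hom.hom ≫ biprod.fst = biprod.fst := congrArg LieObj.Hom.hom f.hom_p
  apply biprod.hom_ext
  · simp [h]
  · simp

instance (L : LieObj C) : (semidirectFunctor L).Full where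
  map_surjective {P Q} f := by
    let f' : P.semidirectPt ⟶ Q.semidirectPt := f
    let k : P.semidirect.X ⟶ Q.semidirect.X := f'.hom.hom
    have hl : biprod.inl ≫ k = biprod.inl := congrArg LieObj.Hom.hom f'.s_hom
    obtain ⟨g, hr⟩ : ∃ g, biprod.inr ≫ k = g ≫ biprod.inr := ⟨_, semidirect_inr_hom f'⟩
    have hk : P.semidirectBracket ≫ k = (k ⊗ₘ k) ≫ Q.semidirectBracket := f'.hom.map_bracket
    have hg : P.alg.bracket ≫ g = (g ⊗ₘ g) ≫ Q.alg.bracket := by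
      rw [← cancel_mono (biprod.inr : _ ⟶ L.X ⊞ Q.alg.X), Category.assoc, ← hr, ← Category.assoc,
        ← semidirectBracket_inr_inr, brk_comp hk, hr, Category.assoc, ← semidirectBracket_inr_inr,
        tensorHom_comp_brk]
    have hg' : IsEquivariant P.act Q.act g := by
      rw [IsEquivariant, ← cancel_mono (biprod.inr : _ ⟶ L.X ⊞ Q.alg.X), Category.assoc, ← hr,
        ← Category.assoc, ← semidirectBracket_inl_inr, brk_comp hk, hr, hl, Category.assoc,
        ← semidirectBracket_inl_inr, ← id_tensorHom, tensorHom_comp_brk, Category.id_comp]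
    refine ⟨⟨⟨g, hg⟩, hg'⟩, Pt.Hom.ext (LieObj.hom_ext ?_)⟩
    change biprod.desc _ _ = k
    apply biprod.hom_ext'
    · exact (biprod.inl_desc _ _).trans hl.symm
    · exact (biprod.inr_desc _ _).trans hr.symm

section Kernel

variable [HasKernels C] (A : Pt L)

/-- The kernel of a point as a Lie algebra. -/
noncomputable abbrev kerBracket : kernel A.p.hom ⊗ kernel A.p.hom ⟶ kernel A.p.hom :=
  kernel.lift _ (brk A.A.bracket (kernel.ι A.p.hom) (kernel.ι A.p.hom)) (by
    rw [brk_comp A.p.map_bracket, kernel.condition, brk_zero])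

omit [HasBinaryBiproducts C] in
theorem kerBracket_ι : kerBracket A ≫ kernel.ι A.p.hom =
    brk A.A.bracket (kernel.ι A.p.hom) (kernel.ι A.p.hom) :=
  kernel.lift_ι _ _ _

/-- The action on the kernel of a point. -/
noncomputable abbrev kerAct : L.X ⊗ kernel A.p.hom ⟶ kernel A.p.hom :=
  kernel.lift _ (brk A.A.bracket A.s.hom (kernel.ι A.p.hom)) (by
    rw [brk_comp A.p.map_bracket, kernel.condition, brk_zero])

omit [HasBinaryBiproducts C] in
theorem kerAct_ι : kerAct A ≫ kernel.ι A.p.hom = brk A.A.bracket A.s.hom (kernel.ι A.p.hom) :=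
  kernel.lift_ι _ _ _

/-- The kernel of a point with the action of the base. -/
noncomputable abbrev ofPt : LieModuleAlgebra L where
  alg := LieObj.ofJointlyMonic (J := Unit) (kerBracket A) (fun _ => kernel.ι A.p.hom)
    (fun h => (cancel_mono _).1 (h ())) (fun _ => kerBracket_ι A)
  act := kerAct A
  isLieAction := by
    have h := A.A.leibniz A.s.hom A.s.hom (kernel.ι A.p.hom)
    have e : brk A.A.bracket A.s.hom A.s.hom = L.bracket ≫ A.s.hom := A.s.map_bracket.symm
    have e₁ : L.bracket ▷ _ ≫ kerAct A ≫ kernel.ι A.p.hom =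
        brk A.A.bracket (L.bracket ≫ A.s.hom) (kernel.ι A.p.hom) := by
      rw [kerAct_ι, ← tensorHom_id, tensorHom_comp_brk, Category.id_comp]
    have e₂ : L.X ◁ kerAct A ≫ kerAct A ≫ kernel.ι A.p.hom =
        brk A.A.bracket A.s.hom (brk A.A.bracket A.s.hom (kernel.ι A.p.hom)) := by
      rw [kerAct_ι, ← id_tensorHom, tensorHom_comp_brk, Category.id_comp, kerAct_ι]
    rw [isLieAction_iff, ← cancel_mono (kernel.ι A.p.hom), Preadditive.sub_comp]
    simp only [Category.assoc, e₁, e₂]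
    rw [← e, h]
  derivation := by
    have h := A.A.leibniz A.s.hom (kernel.ι A.p.hom) (kernel.ι A.p.hom)
    rw [eq_sub_iff_add_eq] at h
    have e₁ : kerAct A ▷ _ ≫ kerBracket A ≫ kernel.ι A.p.hom =
        brk A.A.bracket (brk A.A.bracket A.s.hom (kernel.ι A.p.hom)) (kernel.ι A.p.hom) := by
      rw [kerBracket_ι, ← tensorHom_id, tensorHom_comp_brk, Category.id_comp, kerAct_ι]
    have e₂ : _ ◁ kerAct A ≫ kerBracket A ≫ kernel.ι A.p.hom =
        brk A.A.bracket (kernel.ι A.p.hom) (brk A.A.bracket A.s.hom (kernel.ι A.p.hom)) := by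
      rw [kerBracket_ι, ← id_tensorHom, tensorHom_comp_brk, Category.id_comp, kerAct_ι]
    have e₃ : _ ◁ kerBracket A ≫ kerAct A ≫ kernel.ι A.p.hom =
        brk A.A.bracket A.s.hom (brk A.A.bracket (kernel.ι A.p.hom) (kernel.ι A.p.hom)) := by
      rw [kerAct_ι, ← id_tensorHom, tensorHom_comp_brk, Category.id_comp, kerBracket_ι]
    change tensorAct (kerAct A) (kerAct A) ≫ kerBracket A = _ ◁ kerBracket A ≫ kerAct A
    rw [← cancel_mono (kernel.ι A.p.hom), ← cancel_epi (α_ _ _ _).hom, tensorAct, actLeft, actRight]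
    simp only [Preadditive.add_comp, Preadditive.comp_add, Category.assoc, e₁, e₂, e₃,
      Iso.hom_inv_id_assoc]
    exact h

/-- The inclusion of the kernel of a point. -/
noncomputable abbrev kerι : (ofPt A).alg ⟶ A.A := ⟨kernel.ι A.p.hom, kerBracket_ι A⟩

/-- A point is the semidirect product of its base and its kernel. -/
noncomputable abbrev ofPtDesc : (ofPt A).semidirect ⟶ A.A :=
  semidirectDesc _ A.s (kerι A) (kerAct_ι A)

omit [MonoidalPreadditive C] [HasBinaryBiproducts C] [HasKernels C] in
theorem s_hom_p_hom : A.s.hom ≫ A.p.hom = 𝟙 L.X := congrArg LieObj.Hom.hom A.s_p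

/-- The underlying isomorphism from the semidirect product of the base and the kernel. -/
@[simps]
noncomputable def ofPtIso : L.X ⊞ kernel A.p.hom ≅ A.A.X where
  hom := biprod.desc A.s.hom (kernel.ι A.p.hom)
  inv := biprod.lift A.p.hom (kernel.lift _ (𝟙 _ - A.p.hom ≫ A.s.hom)
    (by simp [Preadditive.sub_comp, s_hom_p_hom]))
  hom_inv_id := by
    have h := s_hom_p_hom A
    apply biprod.hom_ext' <;> apply biprod.hom_ext
    · simp [h]
    · rw [← cancel_mono (kernel.ι A.p.hom)]
      simp [reassoc_of% h]
    · simp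
    · rw [← cancel_mono (kernel.ι A.p.hom)]
      simp
  inv_hom_id := by simp [biprod.lift_desc]

end Kernel

instance [HasKernels C] (L : LieObj C) : (semidirectFunctor L).EssSurj where
  mem_essImage A := by
    let e : (ofPt A).semidirect ≅ A.A := LieObj.isoMk (ofPtIso A) (ofPtDesc A).map_bracket
    have hp : e.hom ≫ A.p = (ofPt A).semidirectFst := LieObj.hom_ext (by
      change biprod.desc _ _ ≫ A.p.hom = biprod.fst
      apply biprod.hom_ext' <;> simp [s_hom_p_hom])
    have hs : (ofPt A).semidirectInl ≫ e.hom = A.s := LieObj.hom_ext (biprod.inl_desc _ _)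
    exact ⟨ofPt A, ⟨Pt.isoMk e hp hs⟩⟩

instance [HasKernels C] (L : LieObj C) : (semidirectFunctor L).IsEquivalence where

section Pullback

variable (q : M ⟶ L)

/-- The comparison between semidirect products of a restricted action and of the action. -/
noncomputable abbrev semidirectRestrict : (restrictObj q P).semidirect ⟶ P.semidirect :=
  semidirectDesc _ (q ≫ P.semidirectInl) P.semidirectInr (by
    have := tensorHom_comp_brk P.semidirectBracket biprod.inl biprod.inr q.hom (𝟙 _)
    rw [Category.id_comp] at this
    change (q.hom ▷ _ ≫ P.act) ≫ biprod.inr =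
      brk P.semidirectBracket (q.hom ≫ biprod.inl) biprod.inr
    rw [← this, semidirectBracket_inl_inr, tensorHom_id, Category.assoc])

theorem semidirectRestrict_fst :
    (semidirectRestrict P q).hom ≫ biprod.fst = biprod.fst ≫ q.hom := by
  change biprod.desc (q.hom ≫ biprod.inl) biprod.inr ≫ biprod.fst = _
  apply biprod.hom_ext' <;> simp

theorem semidirectRestrict_snd : (semidirectRestrict P q).hom ≫ biprod.snd = biprod.snd := by
  change biprod.desc (q.hom ≫ biprod.inl) biprod.inr ≫ biprod.snd = biprod.snd
  apply biprod.hom_ext' <;> simp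

theorem semidirectRestrict_hom_ext {Z : C} {f g : Z ⟶ M.X ⊞ P.alg.X}
    (h₁ : f ≫ biprod.fst = g ≫ biprod.fst)
    (h₂ : f ≫ (semidirectRestrict P q).hom = g ≫ (semidirectRestrict P q).hom) : f = g := by
  apply biprod.hom_ext _ _ h₁
  have h : f ≫ (semidirectRestrict P q).hom ≫ biprod.snd =
      g ≫ (semidirectRestrict P q).hom ≫ biprod.snd := by rw [reassoc_of% h₂]
  rwa [semidirectRestrict_snd] at h

variable {P q}

theorem lift_semidirectRestrict {T : LieObj C} (t₁ : T ⟶ M) (t₂ : T ⟶ P.semidirect)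
    (h : t₁ ≫ q = t₂ ≫ P.semidirectFst) :
    biprod.lift t₁.hom (t₂.hom ≫ biprod.snd) ≫ (semidirectRestrict P q).hom = t₂.hom := by
  have h₁ : biprod.lift t₁.hom (t₂.hom ≫ biprod.snd) ≫ biprod.fst = t₁.hom := biprod.lift_fst _ _
  have h₂ : t₁.hom ≫ q.hom = t₂.hom ≫ biprod.fst := congrArg LieObj.Hom.hom h
  apply biprod.hom_ext
  · rw [Category.assoc, semidirectRestrict_fst, reassoc_of% h₁, h₂]
  · rw [Category.assoc, semidirectRestrict_snd, biprod.lift_snd]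

/-- The morphism to the semidirect product of a restricted action given by its components. -/
noncomputable abbrev semidirectRestrictLift {T : LieObj C} (t₁ : T ⟶ M) (t₂ : T ⟶ P.semidirect)
    (h : t₁ ≫ q = t₂ ≫ P.semidirectFst) : T ⟶ (restrictObj q P).semidirect where
  hom := biprod.lift t₁.hom (t₂.hom ≫ biprod.snd)
  map_bracket := by
    have h₁ : biprod.lift t₁.hom (t₂.hom ≫ biprod.snd) ≫ biprod.fst = t₁.hom := biprod.lift_fst _ _
    apply semidirectRestrict_hom_ext P q
    · rw [Category.assoc, h₁, Category.assoc, (restrictObj q P).semidirectFst.map_bracket,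
        tensorHom_comp_tensorHom_assoc, h₁, t₁.map_bracket]
    · rw [Category.assoc, lift_semidirectRestrict t₁ t₂ h, Category.assoc,
        (semidirectRestrict P q).map_bracket, tensorHom_comp_tensorHom_assoc,
        lift_semidirectRestrict t₁ t₂ h, t₂.map_bracket]

variable (P q)

/-- The semidirect product of a restricted action is a pullback. -/
theorem isPullback_semidirectRestrict : IsPullback (restrictObj q P).semidirectFst
    (semidirectRestrict P q) q P.semidirectFst where
  w := LieObj.hom_ext (semidirectRestrict_fst P q).symm
  isLimit' := ⟨PullbackCone.IsLimit.mk _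
    (fun s => semidirectRestrictLift s.fst s.snd s.condition)
    (fun _ => LieObj.hom_ext (biprod.lift_fst _ _))
    (fun s => LieObj.hom_ext (lift_semidirectRestrict _ _ s.condition))
    (fun s _ h₁ h₂ => LieObj.hom_ext (semidirectRestrict_hom_ext P q
      ((congrArg LieObj.Hom.hom h₁).trans (biprod.lift_fst _ _).symm)
      ((congrArg LieObj.Hom.hom h₂).trans (lift_semidirectRestrict _ _ s.condition).symm)))⟩

variable [HasPullbacks (LieObj C)]

/-- The semidirect product of a restricted action is the pulled back point. -/
noncomputable def restrictObjIso :
    (restrictObj q P).semidirectPt ≅ Pt.baseChange q P.semidirectPt :=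
  Pt.isoMk (isPullback_semidirectRestrict P q).isoPullback
    ((isPullback_semidirectRestrict P q).isoPullback_hom_fst) (by
      dsimp only [Pt.baseChange]
      apply pullback.hom_ext
      · rw [Category.assoc, pullback.lift_fst]
        refine (congrArg _ (isPullback_semidirectRestrict P q).isoPullback_hom_fst).trans ?_
        exact (restrictObj q P).semidirectPt.s_p
      · rw [Category.assoc, pullback.lift_snd]
        refine (congrArg _ (isPullback_semidirectRestrict P q).isoPullback_hom_snd).trans ?_
        exact LieObj.hom_ext (biprod.inl_desc _ _))

omit [HasPullbacks (LieObj C)] in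
theorem semidirectMap_restrict {P Q : LieModuleAlgebra L} (f : P ⟶ Q) :
    semidirectMap (restrictMap q f) ≫ semidirectRestrict Q q =
      semidirectRestrict P q ≫ semidirectMap f := LieObj.hom_ext (by
  change biprod.desc biprod.inl (f.hom.hom ≫ biprod.inr) ≫
    biprod.desc (q.hom ≫ biprod.inl) biprod.inr = biprod.desc (q.hom ≫ biprod.inl) biprod.inr ≫
      biprod.desc biprod.inl (f.hom.hom ≫ biprod.inr)
  apply biprod.hom_ext' <;> simp)

/-- Restriction of actions corresponds to change of base of points. -/
noncomputable def restrictIso :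
    restrict q ⋙ semidirectFunctor M ≅ semidirectFunctor L ⋙ Pt.changeOfBase q :=
  NatIso.ofComponents (fun P => restrictObjIso P q) fun {P Q} f => Pt.Hom.ext (by
    change semidirectMap (restrictMap q f) ≫ (isPullback_semidirectRestrict Q q).isoPullback.hom =
      (isPullback_semidirectRestrict P q).isoPullback.hom ≫
        Pt.baseChangeMap q (semidirectPtMap f)
    apply pullback.hom_ext
    · rw [Category.assoc, Category.assoc, Pt.baseChangeMap_fst]
      refine (congrArg _ (isPullback_semidirectRestrict Q q).isoPullback_hom_fst).trans ?_
      refine Eq.trans ?_ (isPullback_semidirectRestrict P q).isoPullback_hom_fst.symm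
      exact (semidirectPtMap (restrictMap q f)).hom_p
    · rw [Category.assoc, Category.assoc, Pt.baseChangeMap_snd]
      refine (congrArg _ (isPullback_semidirectRestrict Q q).isoPullback_hom_snd).trans ?_
      refine Eq.trans ?_ (Category.assoc _ _ _)
      refine Eq.trans ?_
        (congrArg (· ≫ _) (isPullback_semidirectRestrict P q).isoPullback_hom_snd.symm)
      exact semidirectMap_restrict q f)

theorem isLeftAdjoint_changeOfBase [MonoidalClosed C] [HasColimitsOfShape (Discrete ℕ) C]
    [HasCokernels C] [HasKernels C] [HasEqualizers C] : (Pt.changeOfBase q).IsLeftAdjoint := by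
  have : (semidirectFunctor L ⋙ Pt.changeOfBase q).IsLeftAdjoint :=
    Functor.isLeftAdjoint_of_iso (restrictIso q)
  have : ((semidirectFunctor L).asEquivalence.inverse ⋙
      (semidirectFunctor L).asEquivalence.functor ⋙ Pt.changeOfBase q).IsLeftAdjoint :=
    Functor.isLeftAdjoint_comp _ (semidirectFunctor L ⋙ Pt.changeOfBase q)
  exact Functor.isLeftAdjoint_of_iso ((semidirectFunctor L).asEquivalence.invFunIdAssoc
    (Pt.changeOfBase q))

end Pullback

end LieModuleAlgebra

end SemidirectProduct

theorem monoidalPreadditive_of_monoidalClosed (C : Type u) [Category.{v} C] [Preadditive C]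
    [HasFiniteBiproducts C] [MonoidalCategory C] [SymmetricCategory C] [MonoidalClosed C] :
    MonoidalPreadditive C := by
  have := hasBinaryBiproducts_of_finite_biproducts C
  have hadd (X : C) : (tensorLeft X).Additive := by
    have := (ihom.adjunction X).leftAdjoint_preservesColimits.{0, 0}
    have := preservesBinaryBiproducts_of_preservesBinaryCoproducts (tensorLeft X)
    exact Functor.additive_of_preservesBinaryBiproducts _
  have h0 {X Y Z : C} : X ◁ (0 : Y ⟶ Z) = 0 := (tensorLeft X).map_zero _ _
  have h1 {X Y Z : C} (f g : Y ⟶ Z) : X ◁ (f + g) = X ◁ f + X ◁ g := (tensorLeft X).map_add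
  have h2 {X Y Z : C} (f : Y ⟶ Z) : f ▷ X = (β_ _ _).hom ≫ X ◁ f ≫ (β_ _ _).inv := by simp
  exact
    { whiskerLeft_zero := h0
      zero_whiskerRight := by intros; rw [h2, h0, zero_comp, comp_zero]
      whiskerLeft_add := h1
      add_whiskerRight := by
        intros
        rw [h2, h1, Preadditive.add_comp, Preadditive.comp_add, ← h2, ← h2] }

theorem theorem4p8 (C : Type u) [Category.{v} C] [Preadditive C] [HasFiniteBiproducts C]
    [HasColimits C] [HasFiniteLimits C] [MonoidalCategory C] [SymmetricCategory C]
    [MonoidalClosed C] :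
    LocallyAlgebraicallyCartesianClosed (LieObj C) := by
  have := monoidalPreadditive_of_monoidalClosed C
  have := hasBinaryBiproducts_of_finite_biproducts C
  exact ⟨inferInstance, fun q => LieModuleAlgebra.isLeftAdjoint_changeOfBase q⟩
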